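/- **Model.** There are $n\ge 2$ players and $2$ channels. Each player has one packet, and all players are pending at the start. In each round $t=1,2,\dots$ every pending player either does not transmit or transmits on one of the two channels. Players randomise independently of each other. A pending player who is the only one to transmit on her channel succeeds and leaves the game; all others remain pending. Feedback is ternary: before each round every pending player learns the number $m$ of pending players, and she remembers her own past actions. A protocol prescribes, for each such personal information, a probability distribution over the three actions. The latency $T_i$ of player $i$ is the round of her success ($\infty$ if she never succeeds). After a transmission history of length $t$ at which $i$ is pending, her expected future latency is the conditional expectation of $T_i-t$. A protocol profile is an equilibrium if, after every transmission history (also one of probability zero), no pending player can decrease her expected latency by unilaterally switching to any other protocol from then on. A protocol is anonymous if all players use the same one, and history-independent if its decision rule depends only on the number $m$ of pending players. **Theorem.** There are a sequence $(p_m)_{m\ge 2}$ of real numbers and constants $c,C>0$ such that, for all $m\ge 2$, $$\frac{c}{\sqrt m}\le p_m\le \frac{C}{\sqrt m},$$ and such that for every $n\ge 2$ the following hold. 1. An anonymous, history-independent equilibrium protocol with ternary feedback for $n$ players and $2$ channels exists. 2. It is unique: an anonymous, history-independent protocol is an equilibrium if and only if, whenever $2\le m\le n$ players are pending, each pending player transmits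 on each of the two channels with the same probability $p_m$, and a player who is the only one pending transmits with probability $1$ (on either channel, or on a random one; this is the only freedom). 3. If all players use such an equilibrium protocol, then after every transmission history that leaves $m\ge 2$ players pending, the expected future latency $F$ of every pending player satisfies $$e^{c\sqrt m}\le F\le e^{C\sqrt m}.$$ Thus $p_m=\Theta(1/\sqrt m)$ and the expected future latency is $e^{\Theta(\sqrt m)}$; neither $p_m$ nor the constants depend on $n$. -/

import Mathlib

open scoped ENNReal

namespace Contention

/-- What a pending player does in one round with `k` channels: `none` is no transmission,
`some a` is an attempted transmission on channel `a`. -/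
abbrev Action (k : ℕ) := Option (Fin k)

/-- A transmission history of all `n` players: the list of the transmission vectors of the
rounds played so far, most recent round first. Its length is the time `t`. -/
abbrev History (n k : ℕ) := List (Fin n → Action k)

/-- When the players in `P` are pending and the transmission vector is `x`, player `i` transmits
successfully: she is the only pending player on her channel. -/
def Succeeds {n k : ℕ} (P : Finset (Fin n)) (x : Fin n → Action k) (i : Fin n) : Prop :=
  i ∈ P ∧ ∃ a : Fin k, x i = some a ∧ ∀ j ∈ P, j ≠ i → x j ≠ some a

open Classical in
/-- The set of players that are pending after a history. Initially everybody is pending, and in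
each round exactly the successful players leave. -/
noncomputable def pending {n k : ℕ} : History n k → Finset (Fin n)
  | [] => Finset.univ
  | x :: h => (pending h).filter fun i => ¬ Succeeds (pending h) x i

/-- A protocol with ternary feedback. Its first argument is the information of the player about
the past rounds, most recent first: her own action in that round, and the number of players that
were pending right before that round. Its second argument is the number of players that are
pending now. The value is her mixed strategy for the coming round. The time is one more than the
length of the list, so decision rules may depend on time. -/
abbrev Protocol (k : ℕ) := List (Action k × ℕ) → ℕ → PMF (Action k)

/-- The information of player `i` about the past rounds. -/
noncomputable def personalInfo {n k : ℕ} (i : Fin n) : History n k → List (Action k × ℕ)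
  | [] => []
  | x :: h => (x i, (pending h).card) :: personalInfo i h

/-- The mixed strategy of player `i` in the round that follows the history `h`, under the protocol
profile `f`. Players who are no longer pending do not transmit. -/
noncomputable def strategy {n k : ℕ} (f : Fin n → Protocol k) (h : History n k) (i : Fin n) :
    PMF (Action k) :=
  if i ∈ pending h then f i (personalInfo i h) (pending h).card else PMF.pure none

/-- The law of a transmission vector whose entries are independent with laws `μ i`. -/
noncomputable def jointLaw {n k : ℕ} (μ : Fin n → PMF (Action k)) : PMF (Fin n → Action k) :=
  PMF.ofFintype (fun x => ∏ i, μ i (x i)) (by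
    have hsum : ∀ i, ∑ a, μ i a = 1 := fun i => by
      rw [← tsum_fintype (L := .unconditional _)]; exact (μ i).tsum_coe
    rw [← Fintype.prod_sum fun i a => μ i a]
    simp [hsum])

/-- The law of the transmission history after `s` further rounds, when the history so far is `h`
and from now on all players follow the protocol profile `f`. -/
noncomputable def futureLaw {n k : ℕ} (f : Fin n → Protocol k) (h : History n k) :
    ℕ → PMF (History n k)
  | 0 => PMF.pure h
  | s + 1 => (futureLaw f h s).bind fun h' => (jointLaw (strategy f h')).map fun x => x :: h'

/-- The probability `Pr(T_i > t + s | h, f)` that player `i` is still pending `s` rounds after the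
history `h` of length `t`, where `T_i` is the time of her successful transmission. -/
noncomputable def stillPendingProb {n k : ℕ} (f : Fin n → Protocol k) (h : History n k)
    (i : Fin n) (s : ℕ) : ℝ≥0∞ :=
  (futureLaw f h s).toOuterMeasure {h' | i ∈ pending h'}

/-- The expected future latency `E[T_i | h, f] - t` of a player `i` who is pending after the
history `h` of length `t`. The variable `T_i - t` takes values in `{1, 2, …, ∞}`, so its
expectation is the sum over `s ≥ 0` of the probabilities that it exceeds `s`. -/
noncomputable def futureLatency {n k : ℕ} (f : Fin n → Protocol k) (h : History n k)
    (i : Fin n) : ℝ≥0∞ :=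
  ∑' s : ℕ, stillPendingProb f h i s

/-- The expected latency `E[T_i | h, f]` of a player `i` who is pending after the history `h`. -/
noncomputable def expectedLatency {n k : ℕ} (f : Fin n → Protocol k) (h : History n k)
    (i : Fin n) : ℝ≥0∞ :=
  (h.length : ℝ≥0∞) + futureLatency f h i

/-- The protocol profile `f` is an equilibrium: after no history can a pending player decrease her
expected latency by a unilateral deviation, to any protocol whatsoever, from then on. -/
def IsEquilibrium {n k : ℕ} (f : Fin n → Protocol k) : Prop :=
  ∀ (h : History n k) (i : Fin n), i ∈ pending h → ∀ g : Protocol k,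
    expectedLatency f h i ≤ expectedLatency (Function.update f i g) h i

/-- The history-independent protocol whose decision rule is `q m` whenever `m` players are
pending. -/
def historyIndependent {k : ℕ} (q : ℕ → PMF (Action k)) : Protocol k := fun _ m => q m

/-- The common use of the history-independent protocol given by `q` by all `n` players is an
equilibrium. -/
def IsAnonymousEquilibrium (n : ℕ) {k : ℕ} (q : ℕ → PMF (Action k)) : Prop :=
  IsEquilibrium (fun _ : Fin n => historyIndependent q)

end Contention

/-! Against opponents who use a common rule depending only on `m`, a single player faces a Markov
decision problem with state `m`: nothing else about the past matters. So the rule is an equilibrium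
exactly when, for `1 ≤ m ≤ n`, the latencies `F m` are finite, satisfy the Bellman equation, and
every action in the support of the rule is optimal. Sufficiency is
`isAnonymousEquilibrium_of_bellman`; necessity is `IsAnonymousEquilibrium.latency_le_one_add`
together with `IsAnonymousEquilibrium.latency_ne_top`.

At most two players leave per round, so the equation at `m` involves only `F m`, `F (m - 1)` and `F
(m - 2)`. It is solved by recursion on `m`, and the solution does not depend on `n`. Let `N = m - 1`
opponents use the channels with probabilities `a` and `b`. Chebyshev's sum inequality excludes `a ≠
b` (`not_lt_of_indifferent`). For `a = b = p` two conditions remain for `p` and the increment `D = F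
m - F (m - 1)`: transmission is optimal, and silence is no better, with equality unless `p = 1/2`
(`IsStage`). Eliminating `D` and applying the intermediate value theorem gives a solution.

For uniqueness, pass to the odds `y = p / (1 - p)`. In the quotient of the two equations one side is
strictly decreasing (`odds_ratio_cross_lt`), while the other cannot decrease
(`antitoneOn_probNone_sub`). This needs the previous increment to be nonnegative and small compared
with the latency; these invariants are `IsRegular`. The first three stages are computed by hand.

For the asymptotics put `τ = N y`. A channel is free of opponents with probability `z = (1 + y) ^
(-N)`, and the equations make `z` comparable to `1 / F`, so `τ` is of order `log F`. The silence
equation makes `D` of order `F / τ`. Hence `log F` grows by about `1 / log F` per stage, that is,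
`(log F) ^ 2` grows linearly. So `log F` is of order `√m`, and `p` of order `τ / m`, that is, `1 /
√m`. -/

namespace Contention

/-! ### One round of play: separating the first round, resampling a player, counting departures -/

section Unrolling

variable {n k : ℕ}

/-- The definition appends rounds at the end; Bellman recursions need the first round split off. -/
theorem futureLaw_succ_eq_bind (f : Fin n → Protocol k) (h : History n k) (s : ℕ) :
    futureLaw f h (s + 1) =
      (jointLaw (strategy f h)).bind fun x => futureLaw f (x :: h) s := by
  induction s with
  | zero => simp [futureLaw, PMF.map, Function.comp_def]
  | succ s ih =>
    rw [futureLaw, ih, PMF.bind_bind]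
    rfl

theorem pending_cons_subset (x : Fin n → Action k) (h : History n k) :
    pending (x :: h) ⊆ pending h := by
  classical
  exact Finset.filter_subset _ _

theorem stillPendingProb_zero (f : Fin n → Protocol k) (h : History n k) {i : Fin n}
    (hi : i ∈ pending h) : stillPendingProb f h i 0 = 1 := by
  simp [stillPendingProb, futureLaw, PMF.toOuterMeasure_pure_apply, hi]

theorem stillPendingProb_succ (f : Fin n → Protocol k) (h : History n k) (i : Fin n) (s : ℕ) :
    stillPendingProb f h i (s + 1) =
      ∑ x, jointLaw (strategy f h) x * stillPendingProb f (x :: h) i s := by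
  rw [stillPendingProb, futureLaw_succ_eq_bind, PMF.toOuterMeasure_bind_apply, tsum_fintype]
  rfl

theorem stillPendingProb_of_notMem (f : Fin n → Protocol k) (h : History n k) {i : Fin n}
    (hi : i ∉ pending h) (s : ℕ) : stillPendingProb f h i s = 0 := by
  induction s generalizing h with
  | zero => simp [stillPendingProb, futureLaw, PMF.toOuterMeasure_pure_apply, hi]
  | succ s ih =>
    rw [stillPendingProb_succ]
    refine Finset.sum_eq_zero fun x _ => ?_
    rw [ih _ fun hx => hi (pending_cons_subset x h hx), mul_zero]

theorem jointLaw_apply (μ : Fin n → PMF (Action k)) (x : Fin n → Action k) :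
    jointLaw μ x = ∏ i, μ i (x i) := rfl

theorem sum_pmf_eq_one {α : Type*} [Fintype α] (μ : PMF α) : ∑ a, μ a = 1 := by
  rw [← tsum_fintype (L := .unconditional _)]; exact μ.tsum_coe

/-- A product law is invariant under independent resampling of one coordinate. This separates a
player's own action from those of her opponents. -/
theorem sum_jointLaw_mul_eq_resample (μ : Fin n → PMF (Action k)) (i : Fin n)
    (g : (Fin n → Action k) → ℝ≥0∞) :
    ∑ x, jointLaw μ x * g x =
      ∑ c, μ i c * ∑ x, jointLaw μ x * g (Function.update x i c) := by
  classical
  have hprod : ∀ (x : Fin n → Action k) (c : Action k),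
      μ i (x i) * jointLaw μ (Function.update x i c) = μ i c * jointLaw μ x := by
    intro x c
    rw [jointLaw_apply, jointLaw_apply, ← Finset.mul_prod_erase _ _ (Finset.mem_univ i),
      ← Finset.mul_prod_erase (a := i) _ (fun j => μ j (x j)) (Finset.mem_univ i)]
    rw [Finset.prod_congr rfl (g := fun j => μ j (x j))]
    · simp only [Function.update_self]; ring
    · intro j hj
      rw [Function.update_of_ne (Finset.ne_of_mem_erase hj)]
  -- The involution exchanges `x i` with the fresh sample; `hprod` says that it preserves weights.
  let e : (Fin n → Action k) × Action k ≃ (Fin n → Action k) × Action k :=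
    { toFun := fun p => (Function.update p.1 i p.2, p.1 i)
      invFun := fun p => (Function.update p.1 i p.2, p.1 i)
      left_inv := fun p => by simp
      right_inv := fun p => by simp }
  calc ∑ x, jointLaw μ x * g x
      = ∑ p : (Fin n → Action k) × Action k, μ i p.2 * jointLaw μ p.1 * g p.1 := by
        rw [Fintype.sum_prod_type]
        refine Finset.sum_congr rfl fun x _ => ?_
        simp only [mul_assoc]
        rw [← Finset.sum_mul, sum_pmf_eq_one, one_mul]
    _ = ∑ p : (Fin n → Action k) × Action k,
          μ i p.2 * jointLaw μ p.1 * g (Function.update p.1 i p.2) := by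
        rw [← e.sum_comp]
        refine Finset.sum_congr rfl fun p _ => ?_
        simp only [e, Equiv.coe_fn_mk]
        rw [hprod]
    _ = _ := by
        rw [Fintype.sum_prod_type_right]
        refine Finset.sum_congr rfl fun c _ => ?_
        rw [Finset.mul_sum]
        simp only [mul_assoc]

/-- The number of players in `Q` who transmit on channel `a`. -/
def transmitters (Q : Finset (Fin n)) (x : Fin n → Action k) (a : Fin k) : ℕ :=
  (Q.filter fun j => x j = some a).card

theorem succeeds_iff_transmitters_eq_zero {P : Finset (Fin n)} {x : Fin n → Action k} {i : Fin n}
    (hi : i ∈ P) {a : Fin k} (hx : x i = some a) :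
    Succeeds P x i ↔ transmitters (P.erase i) x a = 0 := by
  simp only [Succeeds, transmitters, Finset.card_eq_zero, Finset.filter_eq_empty_iff,
    Finset.mem_erase]
  constructor
  · rintro ⟨-, b, hb, h⟩ j ⟨hj, hjP⟩
    obtain rfl : a = b := by simpa [hx] using hb
    exact h j hjP hj
  · intro h
    exact ⟨hi, a, hx, fun j hj hji => h ⟨hji, hj⟩⟩

theorem not_succeeds_of_eq_none {P : Finset (Fin n)} {x : Fin n → Action k} {i : Fin n}
    (hx : x i = none) : ¬ Succeeds P x i := by
  rintro ⟨-, a, ha, -⟩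
  simp [hx] at ha

/-- A channel with exactly one transmitter removes one player; any other channel removes nobody. -/
theorem card_pending_cons (x : Fin n → Action k) (h : History n k) :
    (pending (x :: h)).card + ∑ a, (if transmitters (pending h) x a = 1 then 1 else 0) =
      (pending h).card := by
  classical
  set P := pending h with hP
  have hsucc : (P.filter fun j => Succeeds P x j).card =
      ∑ a, (if transmitters P x a = 1 then 1 else 0) := by
    have hU : (P.filter fun j => Succeeds P x j) =
        Finset.univ.biUnion fun a : Fin k => P.filter fun j => Succeeds P x j ∧ x j = some a := by
      ext j
      simp only [Finset.mem_filter, Finset.mem_biUnion, Finset.mem_univ, true_and]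
      constructor
      · rintro ⟨hj, hs⟩
        obtain ⟨-, a, ha, -⟩ := id hs
        exact ⟨a, hj, hs, ha⟩
      · rintro ⟨a, hj, hs, -⟩
        exact ⟨hj, hs⟩
    rw [hU, Finset.card_biUnion]
    · refine Finset.sum_congr rfl fun a _ => ?_
      split_ifs with hone
      · obtain ⟨j, hj⟩ := Finset.card_eq_one.1 hone
        have hjm : j ∈ P ∧ x j = some a := by
          have : j ∈ P.filter fun j => x j = some a := by rw [hj]; simp
          simpa using this
        rw [Finset.card_eq_one]
        refine ⟨j, ?_⟩
        ext l
        simp only [Finset.mem_filter, Finset.mem_singleton]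
        constructor
        · rintro ⟨hl, -, hla⟩
          have : l ∈ P.filter fun j => x j = some a := by simp [hl, hla]
          rw [hj] at this
          simpa using this
        · rintro rfl
          refine ⟨hjm.1, ⟨hjm.1, a, hjm.2, fun l hl hne hla => hne ?_⟩, hjm.2⟩
          have : l ∈ P.filter fun j => x j = some a := by simp [hl, hla]
          rw [hj] at this
          simpa using this
      · rw [Finset.card_eq_zero, Finset.filter_eq_empty_iff]
        rintro j hj ⟨⟨-, b, hb, hall⟩, hja⟩
        obtain rfl : a = b := by simpa [hja] using hb
        refine hone (Finset.card_eq_one.2 ⟨j, ?_⟩)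
        ext l
        simp only [Finset.mem_filter, Finset.mem_singleton]
        constructor
        · rintro ⟨hl, hla⟩
          by_contra hne
          exact hall l hl hne hla
        · rintro rfl
          exact ⟨hj, hja⟩
    · intro a _ b _ hab
      rw [Function.onFun, Finset.disjoint_left]
      intro j hj hj'
      simp only [Finset.mem_filter] at hj hj'
      exact hab (by simpa using hj.2.2.symm.trans hj'.2.2)
  rw [← hsucc, pending, add_comm, ← hP]
  exact Finset.card_filter_add_card_filter_not _

theorem transmitters_erase {P : Finset (Fin n)} {i : Fin n} (hi : i ∈ P) (x : Fin n → Action k)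
    (c : Action k) (a : Fin k) :
    transmitters P (Function.update x i c) a =
      transmitters (P.erase i) x a + if c = some a then 1 else 0 := by
  classical
  conv_lhs => rw [transmitters, ← Finset.insert_erase hi, Finset.filter_insert]
  have hf : ((P.erase i).filter fun j => Function.update x i c j = some a) =
      (P.erase i).filter fun j => x j = some a := by
    refine Finset.filter_congr fun j hj => ?_
    rw [Function.update_of_ne (Finset.ne_of_mem_erase hj)]
  rw [hf, Function.update_self]
  split_ifs with hc
  · rw [Finset.card_insert_of_notMem (by simp), transmitters]
  · rfl

theorem transmitters_update_erase {P : Finset (Fin n)} {i : Fin n} (x : Fin n → Action k)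
    (c : Action k) (a : Fin k) :
    transmitters (P.erase i) (Function.update x i c) a = transmitters (P.erase i) x a := by
  classical
  unfold transmitters
  congr 1
  refine Finset.filter_congr fun j hj => ?_
  rw [Function.update_of_ne (Finset.ne_of_mem_erase hj)]

end Unrolling

/-! ### Reduction to a decision problem in the number of pending players -/

/-- The expectation of `φ A B`, where `A` and `B` are the numbers of players on the two channels
when `N` players act independently with law `ν`. -/
noncomputable def countExp (ν : PMF (Action 2)) : ℕ → (ℕ → ℕ → ℝ≥0∞) → ℝ≥0∞
  | 0, φ => φ 0 0
  | N + 1, φ => ν (some 0) * countExp ν N (fun A B => φ (A + 1) B) +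
      ν (some 1) * countExp ν N (fun A B => φ A (B + 1)) + ν none * countExp ν N φ

theorem sum_action_two {M : Type*} [AddCommMonoid M] (g : Action 2 → M) :
    ∑ c, g c = g (some 0) + g (some 1) + g none := by
  rw [Fintype.sum_option, Fin.sum_univ_two, add_comm]

theorem pmf_action_two (ν : PMF (Action 2)) : ν (some 0) + ν (some 1) + ν none = 1 := by
  rw [← sum_action_two, sum_pmf_eq_one]

theorem countExp_mono (ν : PMF (Action 2)) {N : ℕ} {φ ψ : ℕ → ℕ → ℝ≥0∞}
    (h : ∀ A B, A + B ≤ N → φ A B ≤ ψ A B) : countExp ν N φ ≤ countExp ν N ψ := by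
  induction N generalizing φ ψ with
  | zero => exact h 0 0 le_rfl
  | succ N ih =>
    unfold countExp
    gcongr
    · exact ih fun A B hAB => h _ _ (by omega)
    · exact ih fun A B hAB => h _ _ (by omega)
    · exact ih fun A B hAB => h _ _ (by omega)

theorem countExp_const (ν : PMF (Action 2)) (N : ℕ) (C : ℝ≥0∞) :
    countExp ν N (fun _ _ => C) = C := by
  induction N with
  | zero => rfl
  | succ N ih => rw [countExp, ih, ← add_mul, ← add_mul, pmf_action_two, one_mul]

theorem countExp_add (ν : PMF (Action 2)) (N : ℕ) (φ ψ : ℕ → ℕ → ℝ≥0∞) :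
    countExp ν N (fun A B => φ A B + ψ A B) = countExp ν N φ + countExp ν N ψ := by
  induction N generalizing φ ψ with
  | zero => rfl
  | succ N ih => simp only [countExp]; rw [ih, ih, ih]; ring

theorem countExp_mul_const (ν : PMF (Action 2)) (N : ℕ) (φ : ℕ → ℕ → ℝ≥0∞) (C : ℝ≥0∞) :
    countExp ν N (fun A B => φ A B * C) = countExp ν N φ * C := by
  induction N generalizing φ with
  | zero => rfl
  | succ N ih => simp only [countExp]; rw [ih, ih, ih]; ring

theorem countExp_tsum (ν : PMF (Action 2)) (N : ℕ) (φ : ℕ → ℕ → ℕ → ℝ≥0∞) :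
    countExp ν N (fun A B => ∑' s, φ s A B) = ∑' s, countExp ν N (φ s) := by
  induction N generalizing φ with
  | zero => rfl
  | succ N ih =>
    simp only [countExp]
    rw [ih fun s A B => φ s (A + 1) B, ih fun s A B => φ s A (B + 1), ih φ]
    rw [ENNReal.tsum_add, ENNReal.tsum_add, ENNReal.tsum_mul_left, ENNReal.tsum_mul_left,
      ENNReal.tsum_mul_left]

/-- Resampling the players of `Q` one at a time reproduces the recursion of `countExp`. Players
outside `Q`, such as a deviator, may have any law. -/
theorem sum_jointLaw_transmitters {n : ℕ} (μ : Fin n → PMF (Action 2)) (ν : PMF (Action 2))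
    (Q : Finset (Fin n)) (hQ : ∀ j ∈ Q, μ j = ν) (φ : ℕ → ℕ → ℝ≥0∞) :
    ∑ x, jointLaw μ x * φ (transmitters Q x 0) (transmitters Q x 1) = countExp ν Q.card φ := by
  classical
  induction Q using Finset.induction_on generalizing φ with
  | empty =>
    simp only [transmitters, Finset.filter_empty, Finset.card_empty, countExp]
    rw [← Finset.sum_mul, sum_pmf_eq_one, one_mul]
  | insert i Q hi ih =>
    have ih' := fun φ => ih (fun j hj => hQ j (Finset.mem_insert_of_mem hj)) φ
    rw [Finset.card_insert_of_notMem hi, countExp, sum_jointLaw_mul_eq_resample μ i,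
      hQ i (Finset.mem_insert_self i Q), sum_action_two]
    have herase : (insert i Q).erase i = Q := Finset.erase_insert hi
    simp only [transmitters_erase (Finset.mem_insert_self i Q), herase]
    rw [← ih', ← ih', ← ih']
    simp

/-- The continuation value of a player with action `c`, when `m` players are pending, `A` and `B`
of the others transmit on the two channels, and `G` is the value as a function of the number of
pending players. -/
noncomputable def outcome (G : ℕ → ℝ≥0∞) (m : ℕ) : Action 2 → ℕ → ℕ → ℝ≥0∞
  | none, A, B => G (m - ((if A = 1 then 1 else 0) + if B = 1 then 1 else 0))
  | some 0, A, B => if A = 0 then 0 else G (m - if B = 1 then 1 else 0)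
  | some 1, A, B => if B = 0 then 0 else G (m - if A = 1 then 1 else 0)

/-- The expected continuation value of action `c` against opponents who all use `q m`. -/
noncomputable def actionValue (q : ℕ → PMF (Action 2)) (G : ℕ → ℝ≥0∞) (m : ℕ) (c : Action 2) :
    ℝ≥0∞ :=
  countExp (q m) (m - 1) (outcome G m c)

theorem outcome_mono {G G' : ℕ → ℝ≥0∞} {m : ℕ} (hm : 1 ≤ m)
    (h : ∀ j, 1 ≤ j → j ≤ m → G j ≤ G' j) (c : Action 2) {A B : ℕ} (hAB : A + B ≤ m - 1) :
    outcome G m c A B ≤ outcome G' m c A B := by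
  rcases c with _ | c
  · simp only [outcome]
    apply h
    · split_ifs <;> omega
    · split_ifs <;> omega
  · fin_cases c
    · simp only [outcome]
      by_cases hA : A = 0
      · simp [hA]
      · simp only [hA, if_false]
        apply h
        · split_ifs <;> omega
        · split_ifs <;> omega
    · simp only [outcome]
      by_cases hB : B = 0
      · simp [hB]
      · simp only [hB, if_false]
        apply h
        · split_ifs <;> omega
        · split_ifs <;> omega

theorem actionValue_mono (q : ℕ → PMF (Action 2)) {G G' : ℕ → ℝ≥0∞} {m : ℕ} (hm : 1 ≤ m)
    (h : ∀ j, 1 ≤ j → j ≤ m → G j ≤ G' j) (c : Action 2) :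
    actionValue q G m c ≤ actionValue q G' m c :=
  countExp_mono _ fun _ _ hAB => outcome_mono hm h c hAB

theorem actionValue_congr (q : ℕ → PMF (Action 2)) {G G' : ℕ → ℝ≥0∞} {m : ℕ} (hm : 1 ≤ m)
    (h : ∀ j, 1 ≤ j → j ≤ m → G j = G' j) (c : Action 2) :
    actionValue q G m c = actionValue q G' m c :=
  le_antisymm (actionValue_mono q hm (fun j h1 h2 => (h j h1 h2).le) c)
    (actionValue_mono q hm (fun j h1 h2 => (h j h1 h2).ge) c)

theorem actionValue_tsum (q : ℕ → PMF (Action 2)) (G : ℕ → ℕ → ℝ≥0∞) (m : ℕ) (c : Action 2) :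
    actionValue q (fun j => ∑' s, G s j) m c = ∑' s, actionValue q (G s) m c := by
  unfold actionValue
  rw [← countExp_tsum]
  congr 1
  funext A B
  rcases c with _ | c
  · rfl
  · fin_cases c
    · simp only [outcome]; split_ifs <;> simp
    · simp only [outcome]; split_ifs <;> simp

theorem actionValue_add (q : ℕ → PMF (Action 2)) (G G' : ℕ → ℝ≥0∞) (m : ℕ) (c : Action 2) :
    actionValue q (fun j => G j + G' j) m c = actionValue q G m c + actionValue q G' m c := by
  unfold actionValue
  rw [← countExp_add]
  congr 1
  funext A B
  rcases c with _ | c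
  · rfl
  · fin_cases c
    · simp only [outcome]; split_ifs <;> simp
    · simp only [outcome]; split_ifs <;> simp

theorem actionValue_zero (q : ℕ → PMF (Action 2)) (m : ℕ) (c : Action 2) :
    actionValue q (fun _ => 0) m c = 0 := by
  have h : outcome (fun _ => 0) m c = fun _ _ => 0 := by
    funext A B
    rcases c with _ | c
    · rfl
    · fin_cases c
      · simp [outcome]
      · simp [outcome]
  rw [actionValue, h, countExp_const]

open Classical in
/-- The value `G` at the number of pending players if `i` is pending, and `0` otherwise. -/
noncomputable def pendingValue {n : ℕ} (G : ℕ → ℝ≥0∞) (i : Fin n) (h : History n 2) : ℝ≥0∞ :=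
  if i ∈ pending h then G (pending h).card else 0

/-- Opponents matter only through their numbers on the two channels. This is what collapses
histories to the state `m`. -/
theorem pendingValue_cons {n : ℕ} (G : ℕ → ℝ≥0∞) {i : Fin n} {h : History n 2}
    (hi : i ∈ pending h) (x : Fin n → Action 2) (c : Action 2) :
    pendingValue G i (Function.update x i c :: h) =
      outcome G (pending h).card c (transmitters ((pending h).erase i) x 0)
        (transmitters ((pending h).erase i) x 1) := by
  classical
  have hmem : i ∈ pending (Function.update x i c :: h) ↔
      ¬ Succeeds (pending h) (Function.update x i c) i := by
    rw [pending, Finset.mem_filter]; simp [hi]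
  have hcard := card_pending_cons (Function.update x i c) h
  rw [Fin.sum_univ_two, transmitters_erase hi, transmitters_erase hi] at hcard
  have hsucc : ∀ a, c = some a → (Succeeds (pending h) (Function.update x i c) i ↔
      transmitters ((pending h).erase i) x a = 0) := by
    intro a ha
    rw [succeeds_iff_transmitters_eq_zero hi (a := a) (by simp [ha]), transmitters_update_erase]
  unfold pendingValue
  rcases c with _ | c
  · rw [if_pos (hmem.2 (not_succeeds_of_eq_none (by simp)))]
    simp only [outcome]
    congr 1
    simp at hcard
    omega
  · fin_cases c
    · simp only [Fin.zero_eta, outcome] at *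
      simp only [hmem, hsucc 0 rfl]
      by_cases hA : transmitters ((pending h).erase i) x 0 = 0
      · simp [hA]
      · simp only [hA, not_false_eq_true, if_true, if_false]
        congr 1
        simp [hA] at hcard
        omega
    · simp only [Fin.mk_one, outcome] at *
      simp only [hmem, hsucc 1 rfl]
      by_cases hA : transmitters ((pending h).erase i) x 1 = 0
      · simp [hA]
      · simp only [hA, not_false_eq_true, if_true, if_false]
        congr 1
        simp [hA] at hcard
        omega

/-- The profile in which player `i` uses `g` and everybody else uses the rule `q`. -/
noncomputable def deviation (n : ℕ) (q : ℕ → PMF (Action 2)) (i : Fin n) (g : Protocol 2) :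
    Fin n → Protocol 2 :=
  Function.update (fun _ => historyIndependent q) i g

theorem deviation_self (n : ℕ) (q : ℕ → PMF (Action 2)) (i : Fin n) :
    deviation n q i (historyIndependent q) = fun _ => historyIndependent q := by
  simp [deviation]

theorem sum_jointLaw_mul_pendingValue {n : ℕ} (q : ℕ → PMF (Action 2)) (g : Protocol 2)
    (G : ℕ → ℝ≥0∞) {i : Fin n} {h : History n 2} (hi : i ∈ pending h) :
    ∑ x, jointLaw (strategy (deviation n q i g) h) x * pendingValue G i (x :: h) =
      ∑ c, g (personalInfo i h) (pending h).card c * actionValue q G (pending h).card c := by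
  rw [sum_jointLaw_mul_eq_resample _ i]
  refine Finset.sum_congr rfl fun c _ => ?_
  congr 1
  · simp [strategy, hi, deviation]
  · simp only [pendingValue_cons G hi]
    rw [sum_jointLaw_transmitters _ (q (pending h).card), Finset.card_erase_of_mem hi]
    · rfl
    · intro j hj
      rw [Finset.mem_erase] at hj
      simp [strategy, hj.2, deviation, Function.update_of_ne hj.1, historyIndependent]

/-! ### Bellman equation and verification -/

/-- The probability that a player who uses the rule `r` against the rule `q` is still pending after
`s` rounds, if `m` players are pending at the beginning. -/
noncomputable def survival (r q : ℕ → PMF (Action 2)) : ℕ → ℕ → ℝ≥0∞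
  | 0, _ => 1
  | s + 1, m => ∑ c, r m c * actionValue q (survival r q s) m c

/-- The expected future latency of a player who uses the rule `r` against the rule `q`. -/
noncomputable def latency (r q : ℕ → PMF (Action 2)) (m : ℕ) : ℝ≥0∞ := ∑' s, survival r q s m

theorem stillPendingProb_deviation {n : ℕ} (r q : ℕ → PMF (Action 2)) (i : Fin n)
    (h : History n 2) (s : ℕ) :
    stillPendingProb (deviation n q i (historyIndependent r)) h i s =
      pendingValue (survival r q s) i h := by
  induction s generalizing h with
  | zero =>
    by_cases hi : i ∈ pending h
    · rw [stillPendingProb_zero _ _ hi, pendingValue, if_pos hi]; rfl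
    · rw [stillPendingProb_of_notMem _ _ hi, pendingValue, if_neg hi]
  | succ s ih =>
    by_cases hi : i ∈ pending h
    · rw [stillPendingProb_succ]
      simp only [ih]
      rw [sum_jointLaw_mul_pendingValue q _ _ hi, pendingValue, if_pos hi]
      rfl
    · rw [stillPendingProb_of_notMem _ _ hi, pendingValue, if_neg hi]

theorem futureLatency_deviation {n : ℕ} (r q : ℕ → PMF (Action 2)) {i : Fin n}
    {h : History n 2} (hi : i ∈ pending h) :
    futureLatency (deviation n q i (historyIndependent r)) h i = latency r q (pending h).card := by
  unfold futureLatency latency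
  simp [stillPendingProb_deviation, pendingValue, hi]

theorem latency_eq (r q : ℕ → PMF (Action 2)) (m : ℕ) :
    latency r q m = 1 + ∑ c, r m c * actionValue q (latency r q) m c := by
  have h : latency r q m = survival r q 0 m + ∑' s, survival r q (s + 1) m :=
    tsum_eq_zero_add' ENNReal.summable
  rw [h]
  congr 1
  simp only [survival]
  rw [Summable.tsum_finsetSum fun _ _ => ENNReal.summable]
  refine Finset.sum_congr rfl fun c _ => ?_
  rw [ENNReal.tsum_mul_left, ← actionValue_tsum]
  rfl

/-- A supersolution of the Bellman equation bounds the latency. -/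
theorem latency_le_of_supersolution (r q : ℕ → PMF (Action 2)) (H : ℕ → ℝ≥0∞)
    (hH : ∀ m, 1 ≤ m → 1 + ∑ c, r m c * actionValue q H m c ≤ H m) {m : ℕ} (hm : 1 ≤ m) :
    latency r q m ≤ H m := by
  -- Value iteration from `0` stays below every supersolution. Finiteness of `H` plays no role, so
  -- `⊤` may be put in states that are out of range.
  have key : ∀ S m, 1 ≤ m → ∑ s ∈ Finset.range S, survival r q s m ≤ H m := by
    intro S
    induction S with
    | zero => intro m _; simp
    | succ S ih =>
      intro m hm
      refine le_trans ?_ (hH m hm)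
      rw [Finset.sum_range_succ', add_comm]
      refine add_le_add le_rfl ?_
      simp only [survival]
      rw [Finset.sum_comm]
      refine Finset.sum_le_sum fun c _ => ?_
      rw [← Finset.mul_sum]
      refine mul_le_mul_right ?_ _
      have hsum : ∀ S, ∑ s ∈ Finset.range S, actionValue q (survival r q s) m c =
          actionValue q (fun j => ∑ s ∈ Finset.range S, survival r q s j) m c := by
        intro S
        induction S with
        | zero => simp [actionValue_zero]
        | succ S ih => simp only [Finset.sum_range_succ, ih, actionValue_add]
      rw [hsum]
      exact actionValue_mono q hm (fun j h1 _ => ih j h1) c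
  unfold latency
  rw [ENNReal.tsum_eq_iSup_nat]
  exact iSup_le fun S => key S m hm

/-- The one-step inequality is iterated `S` times along an arbitrary deviation. What is left after
`S` rounds is at most `M`, on the event that the player is still pending. -/
theorem le_one_add_actionValue_deviation {n : ℕ} (q : ℕ → PMF (Action 2)) (F : ℕ → ℝ≥0∞)
    (M : ℝ≥0∞) (hM : ∀ m, 1 ≤ m → m ≤ n → F m ≤ M)
    (hF : ∀ m, 1 ≤ m → m ≤ n → ∀ c, F m ≤ 1 + actionValue q F m c) (i : Fin n) (g : Protocol 2)
    (S : ℕ) (h : History n 2) (hi : i ∈ pending h) :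
    F (pending h).card ≤ ∑ s ∈ Finset.range S, stillPendingProb (deviation n q i g) h i s +
      M * stillPendingProb (deviation n q i g) h i S := by
  have hcard : ∀ h : History n 2, i ∈ pending h → 1 ≤ (pending h).card ∧ (pending h).card ≤ n :=
    fun h hi => ⟨Finset.card_pos.2 ⟨i, hi⟩, by simpa using Finset.card_le_univ (pending h)⟩
  induction S generalizing h with
  | zero =>
    rw [stillPendingProb_zero _ _ hi]
    simpa using hM _ (hcard h hi).1 (hcard h hi).2
  | succ S ih =>
    set f := deviation n q i g with hf
    have hpv : ∀ h : History n 2, pendingValue F i h ≤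
        ∑ s ∈ Finset.range S, stillPendingProb f h i s + M * stillPendingProb f h i S := by
      intro h
      unfold pendingValue
      split_ifs with hi
      · exact ih h hi
      · exact zero_le
    set r := g (personalInfo i h) (pending h).card with hr
    calc F (pending h).card
        = ∑ c, r c * F (pending h).card := by rw [← Finset.sum_mul, sum_pmf_eq_one, one_mul]
      _ ≤ ∑ c, r c * (1 + actionValue q F (pending h).card c) := by
          gcongr with c _
          exact hF _ (hcard h hi).1 (hcard h hi).2 c
      _ = 1 + ∑ x, jointLaw (strategy f h) x * pendingValue F i (x :: h) := by
          rw [sum_jointLaw_mul_pendingValue q g F hi]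
          simp only [mul_add, mul_one, Finset.sum_add_distrib, sum_pmf_eq_one, hr]
      _ ≤ 1 + ∑ x, jointLaw (strategy f h) x *
            (∑ s ∈ Finset.range S, stillPendingProb f (x :: h) i s +
              M * stillPendingProb f (x :: h) i S) := by
          gcongr with x _
          exact hpv _
      _ = _ := by
          rw [Finset.sum_range_succ', stillPendingProb_zero _ _ hi]
          simp only [stillPendingProb_succ, mul_add, Finset.sum_add_distrib, Finset.mul_sum]
          rw [Finset.sum_comm]
          simp only [mul_left_comm M]
          ring

/-- If the latency is finite, its summands, the survival probabilities, tend to `0`, and the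
remainder after truncation vanishes. -/
theorem le_futureLatency_deviation {n : ℕ} (q : ℕ → PMF (Action 2)) (F : ℕ → ℝ≥0∞)
    (M : ℝ≥0∞) (hMtop : M ≠ ⊤) (hM : ∀ m, 1 ≤ m → m ≤ n → F m ≤ M)
    (hF : ∀ m, 1 ≤ m → m ≤ n → ∀ c, F m ≤ 1 + actionValue q F m c) (i : Fin n) (g : Protocol 2)
    (h : History n 2) (hi : i ∈ pending h) :
    F (pending h).card ≤ futureLatency (deviation n q i g) h i := by
  by_cases htop : futureLatency (deviation n q i g) h i = ⊤
  · rw [htop]; exact le_top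
  have h0 := ENNReal.tendsto_atTop_zero_of_tsum_ne_top htop
  have h1 : Filter.Tendsto (fun S => M * stillPendingProb (deviation n q i g) h i S)
      Filter.atTop (nhds 0) := by
    simpa using ENNReal.Tendsto.const_mul h0 (Or.inr hMtop)
  have h2 := (ENNReal.tendsto_nat_tsum
    fun s => stillPendingProb (deviation n q i g) h i s).add h1
  rw [add_zero] at h2
  exact ge_of_tendsto' h2 fun S => le_one_add_actionValue_deviation q F M hM hF i g S h hi

/-- A bounded solution of the optimality equation is the latency of an equilibrium. -/
theorem isAnonymousEquilibrium_of_bellman {n : ℕ} (q : ℕ → PMF (Action 2)) (F : ℕ → ℝ≥0∞)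
    (htop : ∀ m, 1 ≤ m → m ≤ n → F m ≠ ⊤)
    (hF : ∀ m, 1 ≤ m → m ≤ n → ∀ c, F m ≤ 1 + actionValue q F m c)
    (heq : ∀ m, 1 ≤ m → m ≤ n → F m = 1 + ∑ c, q m c * actionValue q F m c) :
    IsAnonymousEquilibrium n q ∧ ∀ (h : History n 2) (i : Fin n), i ∈ pending h →
      futureLatency (fun _ : Fin n => historyIndependent q) h i = F (pending h).card := by
  have hdev := fun i : Fin n => le_futureLatency_deviation q F (∑ m ∈ Finset.Icc 1 n, F m)
    (by
      rw [ENNReal.sum_ne_top]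
      intro m hm
      rw [Finset.mem_Icc] at hm
      exact htop m hm.1 hm.2)
    (fun m h1 h2 => Finset.single_le_sum (f := F) (fun _ _ => zero_le)
      (Finset.mem_Icc.2 ⟨h1, h2⟩)) hF i
  have hval : ∀ (h : History n 2) (i : Fin n), i ∈ pending h →
      futureLatency (fun _ : Fin n => historyIndependent q) h i = F (pending h).card := by
    intro h i hi
    refine le_antisymm ?_ ?_
    · have hn : (pending h).card ≤ n := by simpa using Finset.card_le_univ (pending h)
      have h1 : 1 ≤ (pending h).card := Finset.card_pos.2 ⟨i, hi⟩
      rw [← deviation_self n q i, futureLatency_deviation q q hi]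
      -- `F` is controlled only up to `n`; since the state never increases, `⊤` beyond `n` is
      -- harmless.
      refine (latency_le_of_supersolution q q (fun m => if m ≤ n then F m else ⊤) ?_ h1).trans ?_
      · intro m hm
        split_ifs with hmn
        · rw [heq m hm hmn]
          refine add_le_add le_rfl (Finset.sum_le_sum fun c _ => ?_)
          refine mul_le_mul_right (actionValue_mono q hm (fun j _ hj => ?_) c) _
          rw [if_pos (hj.trans hmn)]
        · exact le_top
      · rw [if_pos hn]
    · have := hdev i (historyIndependent q) h hi
      rwa [deviation_self] at this
  refine ⟨fun h i hi g => ?_, hval⟩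
  unfold expectedLatency
  rw [hval h i hi]
  exact add_le_add le_rfl (hdev i g h hi)

/-- The equilibrium condition holds after all histories, also improbable ones, so one history for
each `m` makes it apply in every state. In each added round one pending player transmits alone. -/
theorem exists_history_card_pending (n k : ℕ) (hk : 1 ≤ k) (m : ℕ) (hm : m ≤ n) :
    ∃ h : History n k, (pending h).card = m := by
  suffices ∀ e ≤ n, ∃ h : History n k, (pending h).card + e = n by
    obtain ⟨h, hh⟩ := this (n - m) (by omega)
    exact ⟨h, by omega⟩
  intro e he
  induction e with
  | zero => exact ⟨[], by simp [pending]⟩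
  | succ e ih =>
    obtain ⟨h, hh⟩ := ih (by omega)
    obtain ⟨i, hi⟩ : (pending h).Nonempty := Finset.card_pos.1 (by omega)
    let a : Fin k := ⟨0, hk⟩
    let x : Fin n → Action k := Function.update (fun _ => none) i (some a)
    have hx : ∀ b, transmitters (pending h) x b = if b = a then 1 else 0 := by
      intro b
      rw [transmitters_erase hi]
      simp [transmitters, eq_comm]
    refine ⟨x :: h, ?_⟩
    have := card_pending_cons x h
    simp only [hx] at this
    have hs : ∑ b : Fin k, (if (if b = a then 1 else 0) = 1 then 1 else 0) = 1 := by
      simp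
    rw [hs] at this
    omega

/-! ### Necessary conditions: optimality of single actions and finiteness -/

section Equilibrium

variable {n : ℕ} {q : ℕ → PMF (Action 2)}

theorem IsAnonymousEquilibrium.latency_le (hq : IsAnonymousEquilibrium n q)
    (r : ℕ → PMF (Action 2)) {m : ℕ} (h1 : 1 ≤ m) (hm : m ≤ n) :
    latency q q m ≤ latency r q m := by
  obtain ⟨h, hh⟩ := exists_history_card_pending n 2 (by norm_num) m hm
  obtain ⟨i, hi⟩ : (pending h).Nonempty := Finset.card_pos.1 (by omega)
  have := hq h i hi (historyIndependent r)
  unfold expectedLatency at this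
  have h2 := (ENNReal.add_le_add_iff_left (ENNReal.natCast_ne_top _)).1 this
  have h3 := futureLatency_deviation r q hi
  have h4 := futureLatency_deviation q q hi
  rw [deviation_self] at h4
  rw [deviation] at h3
  rwa [h3, h4, hh] at h2

/-- Policy improvement: no single action improves on an equilibrium. -/
theorem IsAnonymousEquilibrium.latency_le_one_add (hq : IsAnonymousEquilibrium n q)
    {m : ℕ} (h1 : 1 ≤ m) (hm : m ≤ n) (c : Action 2) :
    latency q q m ≤ 1 + actionValue q (latency q q) m c := by
  by_contra! hlt
  -- The deviation plays `c` at every visit to `m`. If `c` improves once, `latency q q` is a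
  -- supersolution for this deviation.
  let r : ℕ → PMF (Action 2) := Function.update q m (PMF.pure c)
  have hsup : ∀ j, 1 ≤ j → latency r q j ≤ latency q q j := by
    intro j hj
    refine latency_le_of_supersolution r q (latency q q) (fun l hl => ?_) hj
    by_cases hlm : l = m
    · subst hlm
      refine le_trans ?_ hlt.le
      simp [r, PMF.pure_apply]
    · simp only [r, Function.update_of_ne hlm]
      exact (latency_eq q q l).ge
  have h2 : latency r q m ≤ 1 + actionValue q (latency q q) m c := by
    rw [latency_eq r q m]
    refine add_le_add le_rfl ?_
    refine le_trans ?_ (actionValue_mono q h1 (fun j hj _ => hsup j hj) c)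
    simp [r, PMF.pure_apply]
  exact absurd (hq.latency_le r h1 hm) (not_le.2 (h2.trans_lt hlt))

theorem countExp_eq_zero_fst (ν : PMF (Action 2)) (N : ℕ) :
    countExp ν N (fun A _ => if A = 0 then 1 else 0) = (ν (some 1) + ν none) ^ N := by
  induction N with
  | zero => simp [countExp]
  | succ N ih =>
    rw [countExp, ih]
    simp only [Nat.succ_ne_zero, if_false, countExp_const]
    ring

theorem countExp_eq_zero_snd (ν : PMF (Action 2)) (N : ℕ) :
    countExp ν N (fun _ B => if B = 0 then 1 else 0) = (ν (some 0) + ν none) ^ N := by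
  induction N with
  | zero => simp [countExp]
  | succ N ih =>
    rw [countExp, ih]
    simp only [Nat.succ_ne_zero, if_false, countExp_const]
    ring

/-- Some channel is free of opponents with positive probability `z`. After a failure there at most
one player has left, through the other channel, so the continuation value is `G m` or `G (m - 1)`;
the sum bounds both. -/
theorem exists_countExp_outcome_le (ν : PMF (Action 2)) (N : ℕ) :
    ∃ (c : Action 2) (z : ℝ≥0∞), z ≠ 0 ∧ ∃ e, e + z = 1 ∧ ∀ (G : ℕ → ℝ≥0∞) (m : ℕ),
      countExp ν N (outcome G m c) ≤ e * (G m + G (m - 1)) := by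
  by_cases h0 : ν (some 1) + ν none = 0
  · refine ⟨some 1, (ν (some 0) + ν none) ^ N, ?_,
      countExp ν N (fun _ B => if B = 0 then 0 else 1), ?_, fun G m => ?_⟩
    · have := pmf_action_two ν
      rw [add_assoc, h0, add_zero] at this
      rw [this]
      exact pow_ne_zero _ (by simp)
    · rw [← countExp_eq_zero_snd, ← countExp_add]
      refine Eq.trans ?_ (countExp_const ν N 1)
      congr 1; funext A B; split_ifs <;> simp
    · rw [← countExp_mul_const]
      refine countExp_mono ν fun A B _ => ?_
      simp only [outcome]
      by_cases hB : B = 0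
      · simp [hB]
      · by_cases hA : A = 1
        · simp [hA, hB]
        · simp [hA, hB]
  · refine ⟨some 0, (ν (some 1) + ν none) ^ N, pow_ne_zero _ h0,
      countExp ν N (fun A _ => if A = 0 then 0 else 1), ?_, fun G m => ?_⟩
    · rw [← countExp_eq_zero_fst, ← countExp_add]
      refine Eq.trans ?_ (countExp_const ν N 1)
      congr 1; funext A B; split_ifs <;> simp
    · rw [← countExp_mul_const]
      refine countExp_mono ν fun A B _ => ?_
      simp only [outcome]
      by_cases hB : A = 0
      · simp [hB]
      · by_cases hA : B = 1
        · simp [hA, hB]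
        · simp [hA, hB]

/-- Insisting on the channel of the previous lemma leaves state `m` after a geometric time at the
latest, so finiteness passes from smaller states to `m`. -/
theorem IsAnonymousEquilibrium.latency_ne_top (hq : IsAnonymousEquilibrium n q)
    {m : ℕ} (h1 : 1 ≤ m) (hm : m ≤ n) : latency q q m ≠ ⊤ := by
  induction m using Nat.strong_induction_on with
  | _ m ih =>
    set T : ℝ≥0∞ := if m = 1 then 0 else latency q q (m - 1) with hT
    have hTtop : T ≠ ⊤ := by
      rw [hT]
      split_ifs with hm1
      · simp
      · exact ih (m - 1) (by omega) (by omega) (by omega)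
    -- Candidate supersolution: equilibrium latencies below `m`, a constant `K` at `m`, and `⊤`
    -- above. The value `0` at `0` matches `T` when `m = 1`.
    let G : ℝ≥0∞ → ℕ → ℝ≥0∞ := fun K j =>
      if j = m then K else if j = 0 then 0 else if j < m then latency q q j else ⊤
    obtain ⟨c, z, hz, e, hez, hc⟩ : ∃ (c : Action 2) (z : ℝ≥0∞), z ≠ 0 ∧ ∃ e, e + z = 1 ∧
        ∀ K, actionValue q (G K) m c ≤ e * (K + T) := by
      obtain ⟨c, z, hz, e, hez, hc⟩ := exists_countExp_outcome_le (q m) (m - 1)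
      refine ⟨c, z, hz, e, hez, fun K => (hc (G K) m).trans (le_of_eq ?_)⟩
      have hGm : G K m = K := by simp [G]
      have hGT : G K (m - 1) = T := by
        simp only [G, hT]
        by_cases hm1 : m = 1
        · simp [hm1]
        · rw [if_neg (by omega), if_neg (by omega), if_pos (by omega), if_neg hm1]
      rw [hGm, hGT]
    have hztop : z ≠ ⊤ := ne_top_of_le_ne_top ENNReal.one_ne_top (hez ▸ le_add_self)
    have hetop : e ≠ ⊤ := ne_top_of_le_ne_top ENNReal.one_ne_top (hez ▸ le_self_add)
    -- This `K` solves `1 + T + e * K = K`, because `e + z = 1`.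
    set K : ℝ≥0∞ := (1 + T) / z with hK
    have hKtop : K ≠ ⊤ := ENNReal.div_ne_top (by simp [hTtop]) hz
    have hKeq : z * K = 1 + T := ENNReal.mul_div_cancel hz hztop
    have hstep : 1 + e * (K + T) ≤ K := by
      have he1 : e ≤ 1 := hez ▸ le_self_add
      calc 1 + e * (K + T) = 1 + e * T + e * K := by ring
        _ ≤ 1 + 1 * T + e * K := by gcongr
        _ = (e + z) * K := by rw [add_mul, hKeq]; ring
        _ = K := by rw [hez, one_mul]
    let r : ℕ → PMF (Action 2) := Function.update q m (PMF.pure c)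
    have hle : latency r q m ≤ G K m := by
      refine latency_le_of_supersolution r q (G K) (fun l hl => ?_) h1
      rcases lt_trichotomy l m with hlm | hlm | hlm
      · simp only [r, Function.update_of_ne hlm.ne]
        have hGl : ∀ j, 1 ≤ j → j ≤ l → G K j = latency q q j := by
          intro j hj hjl
          simp only [G]
          rw [if_neg (by omega), if_neg (by omega), if_pos (by omega)]
        rw [hGl l hl le_rfl, latency_eq q q l]
        refine add_le_add le_rfl (Finset.sum_le_sum fun c _ => ?_)
        rw [actionValue_congr q hl hGl]
      · subst hlm
        have : G K l = K := by simp [G]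
        rw [this]
        refine le_trans (le_of_eq ?_) ((add_le_add le_rfl (hc K)).trans hstep)
        simp [r, PMF.pure_apply]
      · have : G K l = ⊤ := by
          simp only [G]
          rw [if_neg (by omega), if_neg (by omega), if_neg (by omega)]
        rw [this]; exact le_top
    refine ne_top_of_le_ne_top hKtop ((hq.latency_le r h1 hm).trans (hle.trans ?_))
    simp [G]

end Equilibrium

/-! ### Closed formulas for the action values -/

/-- The real version of `countExp`, for transmission probabilities `a` and `b` and the probability
`d` of no transmission. -/
noncomputable def realCountExp (a b d : ℝ) : ℕ → (ℕ → ℕ → ℝ) → ℝ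
  | 0, φ => φ 0 0
  | N + 1, φ => a * realCountExp a b d N (fun A B => φ (A + 1) B) +
      b * realCountExp a b d N (fun A B => φ A (B + 1)) + d * realCountExp a b d N φ

theorem countExp_ne_top (ν : PMF (Action 2)) {N : ℕ} {φ : ℕ → ℕ → ℝ≥0∞}
    (h : ∀ A B, A + B ≤ N → φ A B ≠ ⊤) : countExp ν N φ ≠ ⊤ := by
  induction N generalizing φ with
  | zero => exact h 0 0 le_rfl
  | succ N ih =>
    simp only [countExp]
    refine ENNReal.add_ne_top.2 ⟨ENNReal.add_ne_top.2 ⟨?_, ?_⟩, ?_⟩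
    · exact ENNReal.mul_ne_top (ν.apply_ne_top _) (ih fun A B hAB => h _ _ (by omega))
    · exact ENNReal.mul_ne_top (ν.apply_ne_top _) (ih fun A B hAB => h _ _ (by omega))
    · exact ENNReal.mul_ne_top (ν.apply_ne_top _) (ih fun A B hAB => h _ _ (by omega))

theorem toReal_countExp (ν : PMF (Action 2)) {N : ℕ} {φ : ℕ → ℕ → ℝ≥0∞}
    (h : ∀ A B, A + B ≤ N → φ A B ≠ ⊤) :
    (countExp ν N φ).toReal = realCountExp (ν (some 0)).toReal (ν (some 1)).toReal
      (ν none).toReal N fun A B => (φ A B).toReal := by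
  induction N generalizing φ with
  | zero => rfl
  | succ N ih =>
    have h1 : ∀ A B, A + B ≤ N → φ (A + 1) B ≠ ⊤ := fun A B hAB => h _ _ (by omega)
    have h2 : ∀ A B, A + B ≤ N → φ A (B + 1) ≠ ⊤ := fun A B hAB => h _ _ (by omega)
    have h3 : ∀ A B, A + B ≤ N → φ A B ≠ ⊤ := fun A B hAB => h _ _ (by omega)
    have t1 := ENNReal.mul_ne_top (ν.apply_ne_top (some 0)) (countExp_ne_top ν h1)
    have t2 := ENNReal.mul_ne_top (ν.apply_ne_top (some 1)) (countExp_ne_top ν h2)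
    have t3 := ENNReal.mul_ne_top (ν.apply_ne_top none) (countExp_ne_top ν h3)
    simp only [countExp, realCountExp]
    rw [ENNReal.toReal_add (ENNReal.add_ne_top.2 ⟨t1, t2⟩) t3, ENNReal.toReal_add t1 t2,
      ENNReal.toReal_mul, ENNReal.toReal_mul, ENNReal.toReal_mul, ih h1, ih h2, ih h3]

section

variable {a b d : ℝ}

theorem realCountExp_add (N : ℕ) (φ ψ : ℕ → ℕ → ℝ) :
    realCountExp a b d N (fun A B => φ A B + ψ A B) =
      realCountExp a b d N φ + realCountExp a b d N ψ := by
  induction N generalizing φ ψ with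
  | zero => rfl
  | succ N ih => simp only [realCountExp]; rw [ih, ih, ih]; ring

theorem realCountExp_const_mul (N : ℕ) (φ : ℕ → ℕ → ℝ) (C : ℝ) :
    realCountExp a b d N (fun A B => C * φ A B) = C * realCountExp a b d N φ := by
  induction N generalizing φ with
  | zero => rfl
  | succ N ih => simp only [realCountExp]; rw [ih, ih, ih]; ring

theorem realCountExp_const (hsum : a + b + d = 1) (N : ℕ) (C : ℝ) :
    realCountExp a b d N (fun _ _ => C) = C := by
  induction N with
  | zero => rfl
  | succ N ih => rw [realCountExp, ih, ← add_mul, ← add_mul, hsum, one_mul]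

theorem realCountExp_zero_fst (hsum : a + b + d = 1) (N : ℕ) :
    realCountExp a b d N (fun A _ => if A = 0 then 1 else 0) = (1 - a) ^ N := by
  induction N with
  | zero => simp [realCountExp]
  | succ N ih =>
    rw [realCountExp, ih]
    simp only [Nat.succ_ne_zero, if_false, realCountExp_const hsum]
    rw [show 1 - a = b + d by linarith]
    ring

theorem realCountExp_zero_snd (hsum : a + b + d = 1) (N : ℕ) :
    realCountExp a b d N (fun _ B => if B = 0 then 1 else 0) = (1 - b) ^ N := by
  induction N with
  | zero => simp [realCountExp]
  | succ N ih =>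
    rw [realCountExp, ih]
    simp only [Nat.succ_ne_zero, if_false, realCountExp_const hsum]
    rw [show 1 - b = a + d by linarith]
    ring

theorem realCountExp_zero_zero (hsum : a + b + d = 1) (N : ℕ) :
    realCountExp a b d N (fun A B => if A = 0 ∧ B = 0 then 1 else 0) = d ^ N := by
  induction N with
  | zero => simp [realCountExp]
  | succ N ih =>
    rw [realCountExp, ih]
    simp only [Nat.succ_ne_zero, false_and, and_false, if_false, realCountExp_const hsum]
    ring

theorem realCountExp_one_fst (hsum : a + b + d = 1) (N : ℕ) :
    realCountExp a b d N (fun A _ => if A = 1 then 1 else 0) = N * a * (1 - a) ^ (N - 1) := by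
  induction N with
  | zero => simp [realCountExp]
  | succ N ih =>
    rw [realCountExp, ih]
    simp only [Nat.add_eq_right, realCountExp_zero_fst hsum]
    have hd : b + d = 1 - a := by linarith
    rw [add_assoc, ← add_mul, hd]
    cases N with
    | zero => simp
    | succ N => simp only [Nat.add_sub_cancel]; push_cast; ring

theorem realCountExp_one_snd (hsum : a + b + d = 1) (N : ℕ) :
    realCountExp a b d N (fun _ B => if B = 1 then 1 else 0) = N * b * (1 - b) ^ (N - 1) := by
  induction N with
  | zero => simp [realCountExp]
  | succ N ih =>
    rw [realCountExp, ih]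
    simp only [Nat.add_eq_right, realCountExp_zero_snd hsum]
    have hd : a = 1 - b - d := by linarith
    cases N with
    | zero => simp
    | succ N => simp only [Nat.add_sub_cancel]; push_cast; rw [hd]; ring

theorem realCountExp_zero_one (hsum : a + b + d = 1) (N : ℕ) :
    realCountExp a b d N (fun A B => if A = 0 ∧ B = 1 then 1 else 0) = N * b * d ^ (N - 1) := by
  induction N with
  | zero => simp [realCountExp]
  | succ N ih =>
    rw [realCountExp, ih]
    simp only [Nat.add_eq_right, Nat.succ_ne_zero, false_and, if_false, realCountExp_const hsum,
      realCountExp_zero_zero hsum]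
    cases N with
    | zero => simp
    | succ N => simp only [Nat.add_sub_cancel]; push_cast; ring

theorem realCountExp_one_zero (hsum : a + b + d = 1) (N : ℕ) :
    realCountExp a b d N (fun A B => if A = 1 ∧ B = 0 then 1 else 0) = N * a * d ^ (N - 1) := by
  induction N with
  | zero => simp [realCountExp]
  | succ N ih =>
    rw [realCountExp, ih]
    simp only [Nat.add_eq_right, Nat.succ_ne_zero, and_false, if_false, realCountExp_const hsum,
      realCountExp_zero_zero hsum]
    cases N with
    | zero => simp
    | succ N => simp only [Nat.add_sub_cancel]; push_cast; ring

theorem realCountExp_one_one (hsum : a + b + d = 1) (N : ℕ) :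
    realCountExp a b d N (fun A B => if A = 1 ∧ B = 1 then 1 else 0) =
      N * (N - 1 : ℝ) * a * b * d ^ (N - 2) := by
  induction N with
  | zero => simp [realCountExp]
  | succ N ih =>
    rw [realCountExp, ih]
    simp only [Nat.add_eq_right, realCountExp_zero_one hsum, realCountExp_one_zero hsum]
    rcases N with _ | _ | N
    · simp
    · simp; ring
    · simp only [Nat.add_sub_cancel]
      push_cast
      ring

end

section ActionValue

variable {q : ℕ → PMF (Action 2)} {G : ℕ → ℝ≥0∞} {m : ℕ}

theorem outcome_ne_top (hm : 1 ≤ m) (h : ∀ j, 1 ≤ j → j ≤ m → G j ≠ ⊤) (c : Action 2) {A B : ℕ}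
    (hAB : A + B ≤ m - 1) : outcome G m c A B ≠ ⊤ := by
  rcases c with _ | c
  · simp only [outcome]
    apply h
    · split_ifs <;> omega
    · split_ifs <;> omega
  · fin_cases c
    · simp only [outcome]
      by_cases hA : A = 0
      · simp [hA]
      · simp only [hA, if_false]
        apply h
        · split_ifs <;> omega
        · split_ifs <;> omega
    · simp only [outcome]
      by_cases hB : B = 0
      · simp [hB]
      · simp only [hB, if_false]
        apply h
        · split_ifs <;> omega
        · split_ifs <;> omega

theorem actionValue_ne_top (hm : 1 ≤ m) (h : ∀ j, 1 ≤ j → j ≤ m → G j ≠ ⊤) (c : Action 2) :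
    actionValue q G m c ≠ ⊤ :=
  countExp_ne_top _ fun _ _ hAB => outcome_ne_top hm h c hAB

variable {N : ℕ} {a b d f D D' : ℝ}

/-- Inclusion-exclusion over the events of a single opponent on each channel. Two departures lower
the value by `D + D'` and not by `2 * D`, whence the correction `D - D'`. -/
theorem toReal_actionValue_none (h : ∀ j, 1 ≤ j → j ≤ N + 1 → G j ≠ ⊤)
    (ha : (q (N + 1) (some 0)).toReal = a) (hb : (q (N + 1) (some 1)).toReal = b)
    (hd : (q (N + 1) none).toReal = d) (hsum : a + b + d = 1)
    (hf : (G (N + 1)).toReal = f) (hD : (G N).toReal = f - D)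
    (hD' : (G (N - 1)).toReal = f - D - D') :
    (actionValue q G (N + 1) none).toReal =
      f - D * (N * a * (1 - a) ^ (N - 1)) - D * (N * b * (1 - b) ^ (N - 1)) +
        (D - D') * (N * (N - 1 : ℝ) * a * b * d ^ (N - 2)) := by
  unfold actionValue
  rw [toReal_countExp _ fun A B hAB => outcome_ne_top (by omega) h _ hAB, ha, hb, hd,
    Nat.add_sub_cancel]
  have hφ : (fun A B => (outcome G (N + 1) none A B).toReal) = fun A B : ℕ =>
      (f + (-D) * (if A = 1 then 1 else 0)) + ((-D) * (if B = 1 then 1 else 0) +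
        (D - D') * (if A = 1 ∧ B = 1 then 1 else 0)) := by
    funext A B
    simp only [outcome]
    by_cases hA : A = 1 <;> by_cases hB : B = 1
    · simp [hA, hB, hD']; ring
    · simp [hA, hB, hD]; ring
    · simp [hA, hB, hD]; ring
    · simp [hA, hB, hf]
  rw [hφ, realCountExp_add, realCountExp_add, realCountExp_add, realCountExp_const_mul,
    realCountExp_const_mul, realCountExp_const_mul, realCountExp_const hsum,
    realCountExp_one_fst hsum, realCountExp_one_snd hsum, realCountExp_one_one hsum]
  ring

/-- The last term restores the `D` that was subtracted for a departure on the other channel although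
the player herself had succeeded. -/
theorem toReal_actionValue_zero (h : ∀ j, 1 ≤ j → j ≤ N + 1 → G j ≠ ⊤)
    (ha : (q (N + 1) (some 0)).toReal = a) (hb : (q (N + 1) (some 1)).toReal = b)
    (hd : (q (N + 1) none).toReal = d) (hsum : a + b + d = 1)
    (hf : (G (N + 1)).toReal = f) (hD : (G N).toReal = f - D) :
    (actionValue q G (N + 1) (some 0)).toReal =
      f - f * (1 - a) ^ N - D * (N * b * (1 - b) ^ (N - 1)) + D * (N * b * d ^ (N - 1)) := by
  unfold actionValue
  rw [toReal_countExp _ fun A B hAB => outcome_ne_top (by omega) h _ hAB, ha, hb, hd,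
    Nat.add_sub_cancel]
  have hφ : (fun A B => (outcome G (N + 1) (some 0) A B).toReal) = fun A B : ℕ =>
      (f + (-f) * (if A = 0 then 1 else 0)) + ((-D) * (if B = 1 then 1 else 0) +
        D * (if A = 0 ∧ B = 1 then 1 else 0)) := by
    funext A B
    simp only [outcome]
    by_cases hA : A = 0 <;> by_cases hB : B = 1
    · simp [hA, hB]
    · simp [hA, hB]
    · simp [hA, hB, hD]; ring
    · simp [hA, hB, hf]
  rw [hφ, realCountExp_add, realCountExp_add, realCountExp_add, realCountExp_const_mul,
    realCountExp_const_mul, realCountExp_const_mul, realCountExp_const hsum,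
    realCountExp_zero_fst hsum, realCountExp_one_snd hsum, realCountExp_zero_one hsum]
  ring

theorem toReal_actionValue_one (h : ∀ j, 1 ≤ j → j ≤ N + 1 → G j ≠ ⊤)
    (ha : (q (N + 1) (some 0)).toReal = a) (hb : (q (N + 1) (some 1)).toReal = b)
    (hd : (q (N + 1) none).toReal = d) (hsum : a + b + d = 1)
    (hf : (G (N + 1)).toReal = f) (hD : (G N).toReal = f - D) :
    (actionValue q G (N + 1) (some 1)).toReal =
      f - f * (1 - b) ^ N - D * (N * a * (1 - a) ^ (N - 1)) + D * (N * a * d ^ (N - 1)) := by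
  unfold actionValue
  rw [toReal_countExp _ fun A B hAB => outcome_ne_top (by omega) h _ hAB, ha, hb, hd,
    Nat.add_sub_cancel]
  have hφ : (fun A B => (outcome G (N + 1) (some 1) A B).toReal) = fun A B : ℕ =>
      (f + (-f) * (if B = 0 then 1 else 0)) + ((-D) * (if A = 1 then 1 else 0) +
        D * (if A = 1 ∧ B = 0 then 1 else 0)) := by
    funext A B
    simp only [outcome]
    by_cases hA : A = 1 <;> by_cases hB : B = 0
    · simp [hA, hB]
    · simp [hA, hB, hD]; ring
    · simp [hA, hB]
    · simp [hA, hB, hf]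
  rw [hφ, realCountExp_add, realCountExp_add, realCountExp_add, realCountExp_const_mul,
    realCountExp_const_mul, realCountExp_const_mul, realCountExp_const hsum,
    realCountExp_zero_snd hsum, realCountExp_one_fst hsum, realCountExp_one_zero hsum]
  ring

end ActionValue

/-! ### Unequal use of the channels is impossible -/

section Asymmetric

theorem antitoneOn_pow_mul_pow {d t : ℝ} (hd : 0 ≤ d) (hdt : d ≤ t) (K : ℕ) :
    AntitoneOn (fun i => d ^ i * t ^ (K - i)) (Finset.range (K + 1) : Set ℕ) := by
  intro i hi j hj hij
  simp only [Finset.coe_range, Set.mem_Iio] at hi hj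
  obtain ⟨e, rfl⟩ := Nat.exists_eq_add_of_le hij
  have h1 : K - i = e + (K - (i + e)) := by omega
  have : 0 ≤ t := hd.trans hdt
  simp only [h1, pow_add, mul_assoc]
  gcongr

theorem monotoneOn_pow_mul_pow {d s : ℝ} (hd : 0 ≤ d) (hds : d ≤ s) (K : ℕ) :
    MonotoneOn (fun i => s ^ i * d ^ (K - i)) (Finset.range (K + 1) : Set ℕ) := by
  intro i hi j hj hij
  simp only [Finset.coe_range, Set.mem_Iio] at hi hj
  obtain ⟨e, rfl⟩ := Nat.exists_eq_add_of_le hij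
  have h1 : K - i = e + (K - (i + e)) := by omega
  have : 0 ≤ s := hd.trans hds
  simp only [h1, pow_add, mul_assoc]
  gcongr

/-- Chebyshev's sum inequality for the geometric sums of `s = d + b` and `t = d + a`. -/
theorem mul_geom_sum_le {a b d : ℝ} (ha : 0 ≤ a) (hb : 0 ≤ b) (hd : 0 ≤ d) (K : ℕ) :
    (K + 1) * (a * b * d ^ K * ∑ i ∈ Finset.range (K + 1), (d + b) ^ i * (d + a) ^ (K - i)) ≤
      ((d + a) ^ (K + 1) - d ^ (K + 1)) * ((d + b) ^ (K + 1) - d ^ (K + 1)) := by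
  -- The two factors vary oppositely, and their termwise product splits off the constant `d ^ K`.
  have hcheb := ((antitoneOn_pow_mul_pow hd (le_add_of_nonneg_right ha : d ≤ d + a) K).antivaryOn
    (monotoneOn_pow_mul_pow hd (le_add_of_nonneg_right hb : d ≤ d + b) K)).card_mul_sum_le_sum_mul_sum
  have h1 := geom_sum₂_mul d (d + a) (K + 1)
  have h2 := geom_sum₂_mul (d + b) d (K + 1)
  simp only [Nat.add_sub_cancel] at h1 h2
  have h3 : ∑ i ∈ Finset.range (K + 1), d ^ i * (d + a) ^ (K - i) * ((d + b) ^ i * d ^ (K - i)) =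
      d ^ K * ∑ i ∈ Finset.range (K + 1), (d + b) ^ i * (d + a) ^ (K - i) := by
    rw [Finset.mul_sum]
    refine Finset.sum_congr rfl fun i hi => ?_
    have : d ^ K = d ^ i * d ^ (K - i) := by
      rw [← pow_add]; congr 1; have := Finset.mem_range.1 hi; omega
    rw [this]; ring
  rw [h3, Finset.card_range] at hcheb
  push_cast at hcheb
  calc _ = a * b * ((K + 1) * (d ^ K *
          ∑ i ∈ Finset.range (K + 1), (d + b) ^ i * (d + a) ^ (K - i))) := by ring
    _ ≤ a * b * _ := mul_le_mul_of_nonneg_left hcheb (mul_nonneg ha hb)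
    _ = _ := by rw [← neg_sub, ← h1, ← h2]; ring

/-- With `s = d + b` and `t = d + a`, this contradicts indifference between the channels when
silence is no better. The difference of the sides is `a - b` times the quantity in `hkey`; `a + b +
d = 1` enters through `a * t - b * s = a - b`. -/
theorem pow_sub_pow_mul_lt {a b d : ℝ} (hb : 0 < b) (hab : b < a) (hd : 0 ≤ d)
    (hsum : a + b + d = 1) (K : ℕ) :
    (d + b) ^ (K + 3) * (b * (d + a) ^ (K + 2) - a * (d + b) ^ (K + 2) + (a - b) * d ^ (K + 2)) <
      ((d + a) ^ (K + 3) - (d + b) ^ (K + 3)) *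
        (b * d ^ (K + 2) + a * (d + b) ^ (K + 2) - (K + 2) * (a * b * d ^ (K + 1))) := by
  have ha : 0 < a := hb.trans hab
  have hcheb := mul_geom_sum_le ha.le hb.le hd (K + 1)
  set T := ∑ i ∈ Finset.range (K + 1 + 1), (d + b) ^ i * (d + a) ^ (K + 1 - i) with hT
  have hT0 : 0 ≤ T := Finset.sum_nonneg fun i _ => by positivity
  have hTs : ((d + a) ^ (K + 3) - (d + b) ^ (K + 3)) =
      (a - b) * ((d + a) ^ (K + 2) + (d + b) * T) := by
    have h2 := geom_sum₂_mul (d + b) (d + a) (K + 1 + 1)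
    rw [show K + 1 + 1 - 1 = K + 1 from rfl, ← hT] at h2
    have h3 : (d + b) ^ (K + 2) = (d + a) ^ (K + 2) - (a - b) * T := by linear_combination -h2
    linear_combination (-(d + b)) * h3
  push_cast at hcheb
  set s := d + b with hs
  set t := d + a with ht
  have hs0 : 0 < s := by positivity
  have ht0 : 0 < t := by positivity
  have hst : s ≤ t := by simp only [hs, ht]; linarith
  have hbern : d ^ (K + 2) + (K + 2) * (b * d ^ (K + 1)) ≤ s ^ (K + 2) ∧
      (K + 2) * (b * d ^ (K + 1)) < s ^ (K + 2) := by
    have h1 : d ^ (K + 2) + (K + 2) * (b * d ^ (K + 1)) ≤ s ^ (K + 2) := by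
      have := geom_sum₂_mul s d (K + 2)
      have hle : ∑ i ∈ Finset.range (K + 2), d ^ (K + 1) ≤
          ∑ i ∈ Finset.range (K + 2), s ^ i * d ^ (K + 2 - 1 - i) := by
        refine Finset.sum_le_sum fun i hi => ?_
        have hi' := Finset.mem_range.1 hi
        have h3 : d ^ (K + 1) = d ^ i * d ^ (K + 2 - 1 - i) := by
          rw [← pow_add]; congr 1; omega
        rw [h3]
        gcongr
        linarith
      rw [Finset.sum_const, Finset.card_range, nsmul_eq_mul, Nat.cast_add,
        Nat.cast_ofNat] at hle
      have h4 := mul_le_mul_of_nonneg_right hle hb.le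
      have h5 : s - d = b := by simp [hs]
      rw [h5] at this
      linarith
    refine ⟨h1, ?_⟩
    rcases hd.eq_or_lt with h0 | h0
    · rw [← h0]; simp; positivity
    · have : 0 < d ^ (K + 2) := by positivity
      linarith
  -- `(s * t) ^ (K + 2)` is split into its multiples by `a = 1 - s` and by `s`. The first absorbs
  -- the negative term with `t ^ (K + 2)` by `hbern`, the second the one with `T` by Chebyshev.
  have hkey : 0 < (s * t) ^ (K + 2) + b * d ^ (K + 1) * (d - (K + 2) * a) * (t ^ (K + 2) + s * T) -
      d ^ (K + 2) * s ^ (K + 3) := by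
    have h1 : 0 < a * t ^ (K + 2) * (s ^ (K + 2) - (K + 2) * (b * d ^ (K + 1))) := by
      have := hbern.2
      have : 0 < s ^ (K + 2) - (K + 2) * (b * d ^ (K + 1)) := by linarith
      positivity
    have h2 : 0 ≤ b * d ^ (K + 2) * (t ^ (K + 2) + s * T) := by positivity
    have h3 : 0 ≤ s * d ^ (K + 2) * (t ^ (K + 2) - d ^ (K + 2)) := by
      have : d ^ (K + 2) ≤ t ^ (K + 2) := by gcongr; simp only [ht]; linarith
      have : 0 ≤ t ^ (K + 2) - d ^ (K + 2) := by linarith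
      positivity
    have h4 := mul_le_mul_of_nonneg_left hcheb hs0.le
    have h1s : 1 - s = a := by simp only [hs]; linarith
    have e1 : (s * t) ^ (K + 2) * (1 - s) = a * t ^ (K + 2) * s ^ (K + 2) := by
      rw [h1s, mul_pow]; ring
    rw [mul_pow] at e1 ⊢
    ring_nf at h1 h2 h3 h4 e1 ⊢
    linarith
  have hdiff : a * t - b * s = a - b := by
    have : a * t - b * s = (a - b) * (a + b + d) := by simp only [hs, ht]; ring
    rw [this, hsum, mul_one]
  have hfin := mul_pos (sub_pos.2 hab) hkey
  have hexp : ((t ^ (K + 3) - s ^ (K + 3)) *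
        (b * d ^ (K + 2) + a * s ^ (K + 2) - (K + 2) * (a * b * d ^ (K + 1)))) -
      s ^ (K + 3) * (b * t ^ (K + 2) - a * s ^ (K + 2) + (a - b) * d ^ (K + 2)) =
      (s * t) ^ (K + 2) * (a * t - b * s) +
        (t ^ (K + 3) - s ^ (K + 3)) * (b * d ^ (K + 1) * (d - (K + 2) * a)) -
        (a - b) * (d ^ (K + 2) * s ^ (K + 3)) := by
    rw [mul_pow]; ring
  rw [hdiff, hTs] at hexp
  rw [hTs]
  nlinarith

/-- A player cannot be indifferent between two channels that the others use with different
positive probabilities, unless she prefers to stay silent. -/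
theorem not_lt_of_indifferent {N : ℕ} (hN : 1 ≤ N) {a b d f D D' : ℝ} (hb : 0 < b)
    (hd : 0 ≤ d) (hsum : a + b + d = 1) (hf : 0 < f) (hD' : 0 ≤ D')
    (h12 : f - f * (1 - a) ^ N - D * (N * b * (1 - b) ^ (N - 1)) + D * (N * b * d ^ (N - 1)) =
      f - f * (1 - b) ^ N - D * (N * a * (1 - a) ^ (N - 1)) + D * (N * a * d ^ (N - 1)))
    (h01 : f - f * (1 - a) ^ N - D * (N * b * (1 - b) ^ (N - 1)) + D * (N * b * d ^ (N - 1)) ≤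
      f - D * (N * a * (1 - a) ^ (N - 1)) - D * (N * b * (1 - b) ^ (N - 1)) +
        (D - D') * (N * (N - 1 : ℝ) * a * b * d ^ (N - 2))) : ¬ b < a := by
  intro hab
  have ha : 0 < a := hb.trans hab
  have hs : 1 - a = d + b := by linarith
  have ht : 1 - b = d + a := by linarith
  rw [hs, ht] at h12 h01
  have hst : d + b < d + a := by linarith
  have hs0 : 0 < d + b := by linarith
  have hlt : (d + b) ^ N < (d + a) ^ N := pow_lt_pow_left₀ hst hs0.le (by omega)
  have hflt := mul_pos hf (sub_pos.2 hlt)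
  -- With one or two opponents the coefficient of `D` in the indifference equation vanishes, which
  -- forces equal powers of `s` and `t`.
  rcases N with _ | _ | _ | K
  · omega
  · simp at h12 hflt
    rcases h12 with h | h <;> linarith
  · simp only [zero_add, Nat.reduceAdd, Nat.reduceSub, pow_one, Nat.cast_ofNat] at h12 hflt
    nlinarith
  · simp only [Nat.add_sub_cancel] at *
    rw [show K + 1 + 1 + 1 - 2 = K + 1 by omega] at h01
    rw [show K + 1 + 1 + 1 = K + 3 from rfl, show K + 1 + 1 = K + 2 from rfl] at *
    push_cast at h12 h01
    have hkey := pow_sub_pow_mul_lt hb hab hd hsum K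
    set s := d + b with hs'
    set t := d + a with ht'
    have e1 : f * (t ^ (K + 3) - s ^ (K + 3)) =
        (K + 3) * D * (b * t ^ (K + 2) - a * s ^ (K + 2) + (a - b) * d ^ (K + 2)) := by
      linear_combination h12
    have hK : (0 : ℝ) < K + 3 := by positivity
    -- The bracket is `a * b` times a difference of geometric sums. Its sign and `e1` force `D > 0`.
    have hβ : 0 ≤ b * t ^ (K + 2) - a * s ^ (K + 2) + (a - b) * d ^ (K + 2) := by
      have h1 := geom_sum₂_mul t d (K + 2)
      have h2 := geom_sum₂_mul s d (K + 2)
      have hle : ∑ i ∈ Finset.range (K + 2), s ^ i * d ^ (K + 2 - 1 - i) ≤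
          ∑ i ∈ Finset.range (K + 2), t ^ i * d ^ (K + 2 - 1 - i) := by
        gcongr
      have h3 : t - d = a := by simp [ht']
      have h4 : s - d = b := by simp [hs']
      rw [h3] at h1
      rw [h4] at h2
      have := mul_le_mul_of_nonneg_left hle (mul_nonneg ha.le hb.le)
      linear_combination this + b * h1 - a * h2
    by_cases hD : D ≤ 0
    · have := mul_nonneg hK.le (mul_nonneg (neg_nonneg.2 hD) hβ)
      linarith
    · push Not at hD
      have hw : 0 ≤ D' * ((K + 3) * (K + 2) * a * b * d ^ (K + 1)) := by positivity
      have e2 : (K + 3) * D * (b * d ^ (K + 2) + a * s ^ (K + 2) -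
          (K + 2) * (a * b * d ^ (K + 1))) ≤ f * s ^ (K + 3) := by
        linarith
      have e3 := mul_le_mul_of_nonneg_left e2 (sub_pos.2 hlt).le
      have e4 := mul_lt_mul_of_pos_left hkey (mul_pos hK hD)
      have e5 : s ^ (K + 3) * (f * (t ^ (K + 3) - s ^ (K + 3))) = s ^ (K + 3) * _ :=
        congrArg (s ^ (K + 3) * ·) e1
      linarith

end Asymmetric

/-! ### Uniform bounds for binomial probabilities at one and two -/

section BinomialBounds

/-- The first three terms of the binomial expansion suffice, after completing a square. -/
theorem two_mul_binomial_one_le {p q : ℝ} (hp : 0 ≤ p) (hq : 0 ≤ q) (j : ℕ) :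
    2 * ((j + 2) * p * q ^ (j + 1)) ≤ (p + q) ^ (j + 2) := by
  have h : q ^ (j + 2) + (j + 2) * p * q ^ (j + 1) + (j + 2) * (j + 1) / 2 * p ^ 2 * q ^ j ≤
      (p + q) ^ (j + 2) := by
    induction j with
    | zero => push_cast; apply le_of_eq; ring
    | succ j ih =>
      have h1 := mul_le_mul_of_nonneg_right ih (add_nonneg hp hq)
      have h2 : 0 ≤ ((j : ℝ) + 2) * (j + 1) / 2 * p ^ 3 * q ^ j := by positivity
      push_cast
      ring_nf at h1 h2 ⊢
      linarith
  have h3 : 0 ≤ q ^ j * ((q - (j + 2) * p / 2) ^ 2 + (j + 2) * j / 4 * p ^ 2) := by positivity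
  ring_nf at h h3 ⊢
  linarith

/-- The first five terms of the expansion suffice: terms one and three, and terms zero and four, are
played against term two by completing squares. Equality occurs for four trials and `p = q`. -/
theorem eight_mul_binomial_two_le {p q : ℝ} (hp : 0 ≤ p) (hq : 0 ≤ q) (j : ℕ) :
    4 * ((j + 4) * (j + 3) * p ^ 2 * q ^ (j + 2)) ≤ 3 * (p + q) ^ (j + 4) := by
  have h : q ^ (j + 4) + (j + 4) * p * q ^ (j + 3) + (j + 4) * (j + 3) / 2 * p ^ 2 * q ^ (j + 2) +
      (j + 4) * (j + 3) * (j + 2) / 6 * p ^ 3 * q ^ (j + 1) +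
      (j + 4) * (j + 3) * (j + 2) * (j + 1) / 24 * p ^ 4 * q ^ j ≤ (p + q) ^ (j + 4) := by
    induction j with
    | zero => push_cast; apply le_of_eq; ring
    | succ j ih =>
      have h1 := mul_le_mul_of_nonneg_right ih (add_nonneg hp hq)
      have h2 : 0 ≤ ((j : ℝ) + 4) * (j + 3) * (j + 2) * (j + 1) / 24 * p ^ 5 * q ^ j := by
        positivity
      push_cast
      ring_nf at h1 h2 ⊢
      linarith
  have h3 : 0 ≤ q ^ j * ((j + 4) * p * q *
      ((q - (j + 3) * p / 3) ^ 2 + (j + 3) * j / 18 * p ^ 2)) := by positivity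
  have h4 : 0 ≤ q ^ j * ((q ^ 2 - (j + 4) * (j + 3) / 12 * p ^ 2) ^ 2 +
      (j + 4) * (j + 3) / 144 * (5 * j ^ 2 + 11 * j) * p ^ 4) := by positivity
  ring_nf at h h3 h4 ⊢
  linarith

end BinomialBounds

/-! ### The symmetric stage: existence and small cases -/

section Stage

/-- The probability that none of `N` players is on a given channel. -/
noncomputable def probNone (N : ℕ) (p : ℝ) : ℝ := (1 - p) ^ N

/-- The probability that exactly one of `N` players is on a given channel. -/
noncomputable def probOne (N : ℕ) (p : ℝ) : ℝ := N * p * (1 - p) ^ (N - 1)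

/-- The probability that none of `N` players is on the first channel and exactly one is on the
second. -/
noncomputable def probNoneOne (N : ℕ) (p : ℝ) : ℝ := N * p * (1 - 2 * p) ^ (N - 1)

/-- The probability that exactly one of `N` players is on each of the two channels. -/
noncomputable def probOneOne (N : ℕ) (p : ℝ) : ℝ := N * (N - 1 : ℝ) * p * p * (1 - 2 * p) ^ (N - 2)

/-- The equilibrium conditions for a player with `N` opponents who use each channel with
probability `p`. The latency with one opponent less is `G`, the increment that led to `G` is `D'`,
and the present latency is `G + D`. -/
structure IsStage (N : ℕ) (G D' p D : ℝ) : Prop where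
  pos : 0 < p
  le_half : p ≤ 1 / 2
  transmit : probNone N p * (G + D) + (probOne N p - probNoneOne N p) * D = 1
  silent_le : (2 * probOne N p - probOneOne N p) * D + probOneOne N p * D' ≤ 1
  silent_eq : p < 1 / 2 → (2 * probOne N p - probOneOne N p) * D + probOneOne N p * D' = 1

theorem probNone_pos (N : ℕ) {p : ℝ} (hp' : p ≤ 1 / 2) : 0 < probNone N p :=
  pow_pos (by linarith) _

theorem probNoneOne_le_probOne (N : ℕ) {p : ℝ} (hp : 0 ≤ p) (hp' : p ≤ 1 / 2) :
    probNoneOne N p ≤ probOne N p := by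
  unfold probNoneOne probOne
  have : 0 ≤ 1 - 2 * p := by linarith
  gcongr
  linarith

/-- The coefficient of `D` in the transmission equation is positive, so `p` determines `D`, and `Γ`
has the sign of the remaining defect in the silence condition. Either `Γ` vanishes inside the
interval, or `Γ (1 / 2) ≤ 0` and the boundary point needs only the inequality. -/
theorem exists_isStage (N : ℕ) (G D' : ℝ) : ∃ p D, IsStage N G D' p D := by
  have hden : ∀ p : ℝ, 0 ≤ p → p ≤ 1 / 2 → 0 < probNone N p + probOne N p - probNoneOne N p :=
    fun p h1 h2 => by linarith [probNone_pos N h2, probNoneOne_le_probOne N h1 h2]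
  let Γ : ℝ → ℝ := fun p => (1 - probNone N p * G) * (2 * probOne N p - probOneOne N p) -
    (1 - probOneOne N p * D') * (probNone N p + probOne N p - probNoneOne N p)
  have hcont : Continuous Γ := by
    simp only [Γ, probNone, probOne, probNoneOne, probOneOne]
    fun_prop
  have h0 : Γ 0 = -1 := by
    simp [Γ, probNone, probOne, probNoneOne, probOneOne]
  have hD : ∀ p : ℝ, 0 ≤ p → p ≤ 1 / 2 → probNone N p *
      (G + (1 - probNone N p * G) / (probNone N p + probOne N p - probNoneOne N p)) +
      (probOne N p - probNoneOne N p) *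
        ((1 - probNone N p * G) / (probNone N p + probOne N p - probNoneOne N p)) = 1 := by
    intro p h1 h2
    have := (hden p h1 h2).ne'
    field_simp
    ring
  have hΓ : ∀ p : ℝ, 0 ≤ p → p ≤ 1 / 2 → (2 * probOne N p - probOneOne N p) *
        ((1 - probNone N p * G) / (probNone N p + probOne N p - probNoneOne N p)) +
      probOneOne N p * D' = 1 + Γ p / (probNone N p + probOne N p - probNoneOne N p) := by
    intro p h1 h2
    have := (hden p h1 h2).ne'
    simp only [Γ]
    field_simp
    ring
  by_cases hhalf : Γ (1 / 2) ≤ 0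
  · refine ⟨1 / 2, _, by norm_num, le_rfl, hD _ (by norm_num) le_rfl, ?_,
      fun h => absurd h (lt_irrefl _)⟩
    rw [hΓ _ (by norm_num) le_rfl]
    linarith [div_nonpos_of_nonpos_of_nonneg hhalf (hden (1 / 2) (by norm_num) le_rfl).le]
  · push Not at hhalf
    obtain ⟨p, hp, hp0⟩ := intermediate_value_Ioo (by norm_num : (0 : ℝ) ≤ 1 / 2)
      hcont.continuousOn (show (0 : ℝ) ∈ Set.Ioo (Γ 0) (Γ (1 / 2)) from
        ⟨by rw [h0]; norm_num, hhalf⟩)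
    have heq := hΓ p hp.1.le hp.2.le
    rw [hp0, zero_div, add_zero] at heq
    exact ⟨p, _, hp.1, hp.2.le, hD p hp.1.le hp.2.le, heq.le, fun _ => heq⟩

theorem IsStage.unique_right {N : ℕ} {G D' p D E : ℝ} (h : IsStage N G D' p D)
    (h' : IsStage N G D' p E) : D = E := by
  have hden : 0 < probNone N p + probOne N p - probNoneOne N p := by
    linarith [probNone_pos N h.le_half, probNoneOne_le_probOne N h.pos.le h.le_half]
  have h1 := h.transmit
  have h2 := h'.transmit
  have : (probNone N p + probOne N p - probNoneOne N p) * (D - E) = 0 := by linarith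
  rcases mul_eq_zero.1 this with h3 | h3
  · exact absurd h3 hden.ne'
  · linarith

theorem IsStage.elim {N : ℕ} {G D' p D : ℝ} (h : IsStage N G D' p D) (hp : p < 1 / 2) :
    (1 - probNone N p * G) * (2 * probOne N p - probOneOne N p) =
      (1 - probOneOne N p * D') * (probNone N p + probOne N p - probNoneOne N p) := by
  have h1 := h.transmit
  have h2 := h.silent_eq hp
  linear_combination (-(2 * probOne N p - probOneOne N p)) * h1 +
    (probNone N p + probOne N p - probNoneOne N p) * h2

theorem IsStage.of_one {p D : ℝ} (h : IsStage 1 1 0 p D) : p = 1 / 2 ∧ D = 1 := by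
  have hp : p = 1 / 2 := by
    by_contra hne
    have hlt := lt_of_le_of_ne h.le_half hne
    have h1 := h.elim hlt
    have := h.pos
    simp [probNone, probOne, probOneOne, probNoneOne] at h1
    nlinarith
  subst hp
  have := h.transmit
  norm_num [probNone, probOne, probOneOne, probNoneOne] at this
  exact ⟨rfl, by linarith⟩

theorem IsStage.of_two {p D : ℝ} (h : IsStage 2 2 1 p D) : p = 1 / 2 ∧ D = 2 / 3 := by
  have hp : p = 1 / 2 := by
    by_contra hne
    have hlt := lt_of_le_of_ne h.le_half hne
    have h1 := h.elim hlt
    have := h.pos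
    norm_num [probNone, probOne, probOneOne, probNoneOne] at h1
    nlinarith [mul_pos this (sub_pos.2 hlt), sq_nonneg (p * (1 - 2 * p)), sq_nonneg (p - 1 / 2),
      mul_pos (mul_pos this this) (sub_pos.2 hlt)]
  subst hp
  have := h.transmit
  norm_num [probNone, probOne, probOneOne, probNoneOne] at this
  exact ⟨rfl, by linarith⟩

theorem IsStage.of_three {p D : ℝ} (h : IsStage 3 (8 / 3) (2 / 3) p D) :
    p = 1 / 2 ∧ D = 4 / 3 := by
  have hp : p = 1 / 2 := by
    by_contra hne
    have hlt := lt_of_le_of_ne h.le_half hne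
    have h1 := h.elim hlt
    have := h.pos
    norm_num [probNone, probOne, probOneOne, probNoneOne] at h1
    have hr : 0 < 1 - 2 * p := by linarith
    -- The difference of the two sides of `h1` vanishes at `p = 1/2`; it is `1 - 2 * p` times a form
    -- in `2 * p` and `1 - 2 * p` with positive coefficients.
    have hpos : 0 < (1 - 2 * p) * ((1 - 2 * p) ^ 5 + 19 / 2 * (2 * p) * (1 - 2 * p) ^ 4 +
        57 / 4 * (2 * p) ^ 2 * (1 - 2 * p) ^ 3 + 11 * (2 * p) ^ 3 * (1 - 2 * p) ^ 2 +
        19 / 4 * (2 * p) ^ 4 * (1 - 2 * p) + 3 / 2 * (2 * p) ^ 5) := by positivity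
    ring_nf at h1 hpos
    linarith
  subst hp
  have := h.transmit
  norm_num [probNone, probOne, probOneOne, probNoneOne] at this
  exact ⟨rfl, by linarith⟩

end Stage

/-! ### At least four opponents: odds and positivity of the increment -/

section LargeStage

/-- The probabilities of a stage in terms of the odds `y = p / (1 - p)`. -/
theorem exists_odds (K : ℕ) {p : ℝ} (hp : 0 < p) (hp' : p ≤ 1 / 2) :
    ∃ y : ℝ, 0 < y ∧ y ≤ 1 ∧ (p < 1 / 2 → y < 1) ∧ y = p / (1 - p) ∧ p ≤ y ∧ y ≤ 2 * p ∧
      probNone (K + 4) p * (1 + y) ^ (K + 4) = 1 ∧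
      probOne (K + 4) p = probNone (K + 4) p * ((K + 4) * y) ∧
      probNoneOne (K + 4) p = probNone (K + 4) p * ((K + 4) * y * (1 - y) ^ (K + 3)) ∧
      probOneOne (K + 4) p =
        probNone (K + 4) p * ((K + 4) * (K + 3) * y ^ 2 * (1 - y) ^ (K + 2)) := by
  have h1 : 0 < 1 - p := by linarith
  obtain ⟨y, hy⟩ : ∃ y, y = p / (1 - p) := ⟨_, rfl⟩
  have hpy : p = (1 - p) * y := by rw [hy]; field_simp
  have h2 : 1 - 2 * p = (1 - p) * (1 - y) := by linarith
  have h3 : (1 - p) * (1 + y) = 1 := by linarith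
  have hy0 : 0 < y := by rw [hy]; positivity
  have hn : probNone (K + 4) p = (1 - p) ^ (K + 4) := rfl
  refine ⟨y, hy0, ?_, ?_, hy, ?_, ?_, ?_, ?_, ?_, ?_⟩
  · rw [hy, div_le_one h1]; linarith
  · intro h; rw [hy, div_lt_one h1]; linarith
  · nlinarith
  · nlinarith
  · rw [hn, ← mul_pow, h3, one_pow]
  · rw [hn, probOne]
    rw [show K + 4 - 1 = K + 3 from rfl]
    push_cast
    calc (K + 4) * p * (1 - p) ^ (K + 3) = (K + 4) * ((1 - p) * y) * (1 - p) ^ (K + 3) := by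
          rw [← hpy]
      _ = _ := by ring
  · rw [hn, probNoneOne, h2]
    rw [show K + 4 - 1 = K + 3 from rfl, mul_pow]
    push_cast
    calc (K + 4) * p * ((1 - p) ^ (K + 3) * (1 - y) ^ (K + 3)) =
          (K + 4) * ((1 - p) * y) * ((1 - p) ^ (K + 3) * (1 - y) ^ (K + 3)) := by
          rw [← hpy]
      _ = _ := by ring
  · rw [hn, probOneOne, h2]
    rw [show K + 4 - 2 = K + 2 from rfl, mul_pow]
    push_cast
    calc (K + 4) * (K + 4 - 1) * p * p * ((1 - p) ^ (K + 2) * (1 - y) ^ (K + 2)) =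
          (K + 4) * (K + 4 - 1) * ((1 - p) * y) * ((1 - p) * y) *
            ((1 - p) ^ (K + 2) * (1 - y) ^ (K + 2)) := by
          rw [← hpy]
      _ = _ := by ring

theorem pair_le_three_quarters (K : ℕ) {y : ℝ} (hy : 0 ≤ y) (hy' : y ≤ 1) :
    (K + 4) * (K + 3) * y ^ 2 * (1 - y) ^ (K + 2) ≤ 3 / 4 := by
  have := eight_mul_binomial_two_le hy (sub_nonneg.2 hy') K
  rw [add_sub_cancel, one_pow] at this
  linarith

theorem single_le_half (K : ℕ) {y : ℝ} (hy : 0 ≤ y) (hy' : y ≤ 1) :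
    (K + 3) * y * (1 - y) ^ (K + 2) ≤ 1 / 2 := by
  have := two_mul_binomial_one_le hy (sub_nonneg.2 hy') (K + 1)
  rw [add_sub_cancel, one_pow] at this
  push_cast at this
  rw [show (K : ℝ) + 1 + 2 = K + 3 by ring, show K + 1 + 1 = K + 2 from rfl] at this
  linarith

theorem pair_le_half_mean (K : ℕ) {y : ℝ} (hy : 0 ≤ y) (hy' : y ≤ 1) :
    (K + 4) * (K + 3) * y ^ 2 * (1 - y) ^ (K + 2) ≤ (K + 4) * y / 2 := by
  have := mul_le_mul_of_nonneg_left (single_le_half K hy hy')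
    (by positivity : 0 ≤ ((K : ℝ) + 4) * y)
  linarith

/-- The invariants of the sequence of latencies, at stages with `K + 4` opponents. -/
structure IsRegular (K : ℕ) (G D' : ℝ) : Prop where
  four_le : 4 ≤ G
  le_two_pow : G ≤ 2 ^ (K + 3)
  nonneg : 0 ≤ D'
  le_two_thirds : D' ≤ 2 / 3 * G
  le_third : K = 0 → D' ≤ 1 / 3 * G

variable {K : ℕ} {G D' p D : ℝ}

/-- At `p = 1/2` the bound `G ≤ 2 ^ (K + 3)` leaves half of the transmission equation to `D`. For `p
< 1/2` and `D ≤ 0` the equations contradict `D' ≤ 2/3 * G`: as `W ≤ 3/4`, the constant part `1`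
would have to be at most `1/2`, and the terms in `e` only worsen this. -/
theorem IsStage.increment_pos (hr : IsRegular K G D') (h : IsStage (K + 4) G D' p D) : 0 < D := by
  have h1 := h.transmit
  have hz := probNone_pos (K + 4) h.le_half
  rcases h.le_half.eq_or_lt with hp | hp
  · have huv := probNoneOne_le_probOne (K + 4) h.pos.le h.le_half
    have hzG : probNone (K + 4) p * G ≤ 1 / 2 := by
      have : probNone (K + 4) p = 1 / (2 * 2 ^ (K + 3)) := by
        rw [hp, probNone, show (1 : ℝ) - 1 / 2 = 1 / 2 by norm_num, one_div_pow]
        congr 1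
        ring
      rw [this, div_mul_eq_mul_div, one_mul, div_le_iff₀ (by positivity)]
      linarith [hr.le_two_pow]
    by_contra! hD
    have := mul_nonneg (by linarith : 0 ≤ probNone (K + 4) p +
      (probOne (K + 4) p - probNoneOne (K + 4) p)) (neg_nonneg.2 hD)
    linarith
  · have h2 := h.silent_eq hp
    obtain ⟨y, hy0, hy1, hylt, -, -, -, -, hu, hv, hw⟩ := exists_odds K h.pos h.le_half
    have hW := pair_le_three_quarters K hy0.le hy1
    have hWτ := pair_le_half_mean K hy0.le hy1
    rw [hu, hv] at h1
    rw [hu, hw] at h2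
    have hV0 : 0 ≤ (K + 4) * y * (1 - y) ^ (K + 3) := by
      have : 0 ≤ 1 - y := by linarith
      positivity
    have hW0 : 0 ≤ (K + 4) * (K + 3) * y ^ 2 * (1 - y) ^ (K + 2) := by
      have : 0 ≤ 1 - y := by linarith
      positivity
    have hτ : 0 < (K + 4) * y := by positivity
    set z := probNone (K + 4) p
    set τ := (K + 4) * y
    set V := τ * (1 - y) ^ (K + 3)
    set W := (K + 4) * (K + 3) * y ^ 2 * (1 - y) ^ (K + 2)
    by_contra! hD
    set e := z * -D with he
    have he0 : 0 ≤ e := mul_nonneg hz.le (neg_nonneg.2 hD)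
    have e1 : z * G = 1 + (1 + τ - V) * e := by linear_combination h1
    have e2 : W * (z * D') = 1 + (2 * τ - W) * e := by linear_combination h2
    have e3 : z * D' ≤ 2 / 3 * (z * G) := by
      have := mul_le_mul_of_nonneg_left hr.le_two_thirds hz.le
      linarith
    have e4 := mul_le_mul_of_nonneg_left e3 hW0
    rw [e2, e1] at e4
    have e5 : W * ((1 + τ - V) * e) ≤ W * ((1 + τ) * e) := by
      gcongr; linarith
    have e6 : W * (τ * e) ≤ 3 / 4 * (τ * e) := by gcongr
    have e7 : W * e ≤ τ / 2 * e := by gcongr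
    have e8 : 0 ≤ τ * e := by positivity
    linarith

end LargeStage

/-! ### Uniqueness of the symmetric stage -/

section Uniqueness

/-- Numerator and denominator are, up to division by `(K + 4) * y`, the coefficients of `probNone (K
+ 4) p * D` in the transmission and the silence equation. The division keeps the denominator above
`3/2`. -/
theorem strictAntiOn_odds_ratio (K : ℕ) : StrictAntiOn
    (fun y : ℝ => (1 / ((K + 4) * y) + 1 - (1 - y) ^ (K + 3)) /
      (2 - (K + 3) * y * (1 - y) ^ (K + 2))) (Set.Ioc 0 1) := by
  have hB : ∀ y : ℝ, 0 < y → y ≤ 1 → 0 < 2 - (K + 3) * y * (1 - y) ^ (K + 2) := fun y h0 h1 => by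
    have := single_le_half K h0.le h1
    linarith
  refine strictAntiOn_of_deriv_neg (convex_Ioc 0 1) ?_ ?_
  · intro y hy
    have h1 : ((K : ℝ) + 4) * y ≠ 0 := mul_ne_zero (by positivity) hy.1.ne'
    have h2 := (hB y hy.1 hy.2).ne'
    refine ContinuousAt.continuousWithinAt ?_
    fun_prop (disch := assumption)
  · rw [interior_Ioc]
    intro y hy
    have hy0 := hy.1
    have hl : 0 < 1 - y := by linarith [hy.2]
    have hB' := hB y hy0 hy.2.le
    have hlam : HasDerivAt (fun y : ℝ => 1 - y) (-1) y := by
      simpa using (hasDerivAt_id y).const_sub 1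
    have hpow : ∀ j : ℕ, HasDerivAt (fun y : ℝ => (1 - y) ^ (j + 1)) (-((j + 1) * (1 - y) ^ j)) y := by
      intro j
      refine (hlam.fun_pow (j + 1)).congr_deriv ?_
      rw [Nat.add_sub_cancel]
      push_cast
      ring
    have hτ : HasDerivAt (fun y : ℝ => ((K : ℝ) + 4) * y) (K + 4) y := by
      simpa using (hasDerivAt_id y).const_mul ((K : ℝ) + 4)
    have hσ : HasDerivAt (fun y : ℝ => ((K : ℝ) + 3) * y) (K + 3) y := by
      simpa using (hasDerivAt_id y).const_mul ((K : ℝ) + 3)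
    have hτ0 : ((K : ℝ) + 4) * y ≠ 0 := by positivity
    have hA : HasDerivAt (fun y : ℝ => 1 / ((K + 4) * y) + 1 - (1 - y) ^ (K + 3))
        (-(K + 4) / ((K + 4) * y) ^ 2 + (K + 3) * (1 - y) ^ (K + 2)) y := by
      have h1 := ((hτ.fun_inv hτ0).add_const 1).fun_sub (hpow (K + 2))
      simp only [← one_div] at h1
      refine h1.congr_deriv ?_
      push_cast
      ring
    have hBd : HasDerivAt (fun y : ℝ => 2 - (K + 3) * y * (1 - y) ^ (K + 2))
        (-(K + 3) * (1 - y) ^ (K + 2) + (K + 3) * (K + 2) * y * (1 - y) ^ (K + 1)) y := by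
      refine ((hσ.fun_mul (hpow (K + 1))).const_sub 2).congr_deriv ?_
      push_cast
      ring
    rw [(hA.fun_div hBd hB'.ne').deriv]
    refine div_neg_of_neg_of_pos ?_ (by positivity)
    have hsing := single_le_half K hy0.le hy.2.le
    set L := (1 - y) ^ (K + 1) with hL
    have hL0 : 0 < L := by positivity
    have e2 : (1 - y) ^ (K + 2) = L * (1 - y) := by rw [hL]; ring
    have e3 : (1 - y) ^ (K + 3) = L * (1 - y) ^ 2 := by rw [hL]; ring
    rw [e2] at hsing
    rw [e2, e3]
    have hk : (0 : ℝ) ≤ K := Nat.cast_nonneg K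
    -- A quadratic in `y` with negative discriminant, since `(K + 6) ^ 2 < 2 * (K + 4) * (K + 5)`.
    have hquad : 3 * ((K + 4) * y) * (1 - y) - (K + 2) * y * (1 + (K + 4) * y) < 2 * (1 - y) := by
      nlinarith [sq_nonneg ((K + 4) * (K + 5) * y - (K + 6)), mul_nonneg hk hk]
    have hω0 : 0 < (K + 3) * y * L := by positivity
    have h1 := mul_lt_mul_of_pos_left hquad hω0
    have h2 : 0 ≤ (K + 4) * y * ((K + 3) * y ^ 2 * L ^ 2 * (1 - y) ^ 2) := by positivity
    have h3 : 0 ≤ (K + 3) * y * L * ((K + 4) * y * (L * (1 - y) ^ 2)) * (1 - y) := by positivity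
    -- Clearing denominators, the numerator of the derivative is below `-2 + 4 * (K + 3) * y * (1 -
    -- y) ^ (K + 2)`, which `hsing` makes nonpositive.
    have hmul : (K + 4) * y ^ 2 *
        ((-(K + 4) / ((K + 4) * y) ^ 2 + (K + 3) * (L * (1 - y))) *
            (2 - (K + 3) * y * (L * (1 - y))) -
          (1 / ((K + 4) * y) + 1 - L * (1 - y) ^ 2) *
            (-(K + 3) * (L * (1 - y)) + (K + 3) * (K + 2) * y * L)) < 0 := by
      have hexp : (K + 4) * y ^ 2 *
        ((-(K + 4) / ((K + 4) * y) ^ 2 + (K + 3) * (L * (1 - y))) *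
            (2 - (K + 3) * y * (L * (1 - y))) -
          (1 / ((K + 4) * y) + 1 - L * (1 - y) ^ 2) *
            (-(K + 3) * (L * (1 - y)) + (K + 3) * (K + 2) * y * L)) =
          (-1 + (K + 4) * y ^ 2 * ((K + 3) * (L * (1 - y)))) *
            (2 - (K + 3) * y * (L * (1 - y))) -
          (1 + (K + 4) * y - (K + 4) * y * (L * (1 - y) ^ 2)) *
            (y * (-(K + 3) * (L * (1 - y)) + (K + 3) * (K + 2) * y * L)) := by
        field_simp
      rw [hexp]
      ring_nf at h1 h2 h3 hsing ⊢
      linarith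
    exact neg_of_mul_neg_right hmul (by positivity)

theorem odds_ratio_cross_lt (K : ℕ) {y y' : ℝ} (hy : 0 < y) (hlt : y < y') (hy' : y' ≤ 1) :
    (1 + (K + 4) * y' - (K + 4) * y' * (1 - y') ^ (K + 3)) *
        (2 * ((K + 4) * y) - (K + 4) * (K + 3) * y ^ 2 * (1 - y) ^ (K + 2)) <
      (1 + (K + 4) * y - (K + 4) * y * (1 - y) ^ (K + 3)) *
        (2 * ((K + 4) * y') - (K + 4) * (K + 3) * y' ^ 2 * (1 - y') ^ (K + 2)) := by
  have hy0' : 0 < y' := hy.trans hlt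
  have h := strictAntiOn_odds_ratio K ⟨hy, (hlt.trans_le hy').le⟩ ⟨hy0', hy'⟩ hlt
  have hB : ∀ y : ℝ, 0 < y → y ≤ 1 → 0 < 2 - (K + 3) * y * (1 - y) ^ (K + 2) := fun y h0 h1 => by
    have := single_le_half K h0.le h1
    linarith
  simp only at h
  rw [div_lt_div_iff₀ (hB y' hy0' hy') (hB y hy (hlt.trans_le hy').le)] at h
  have hτ : 0 < (K + 4) * y := by positivity
  have hτ' : 0 < (K + 4) * y' := by positivity
  have h2 := mul_lt_mul_of_pos_left h (mul_pos hτ hτ')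
  have e : ∀ t c : ℝ, 0 < t → t * (1 / t + 1 - c) = 1 + t - t * c := by
    intro t c ht
    field_simp
  calc _ = ((K + 4) * y' * (1 / ((K + 4) * y') + 1 - (1 - y') ^ (K + 3))) *
        ((K + 4) * y * (2 - (K + 3) * y * (1 - y) ^ (K + 2))) := by
        rw [e _ _ hτ']; ring
    _ < ((K + 4) * y * (1 / ((K + 4) * y) + 1 - (1 - y) ^ (K + 3))) *
        ((K + 4) * y' * (2 - (K + 3) * y' * (1 - y') ^ (K + 2))) := by
        linarith
    _ = _ := by rw [e _ _ hτ]; ring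

variable {K : ℕ} {G D' : ℝ}

/-- The only term of the wrong sign in the derivative is a binomial weight at two, with `K + 3`
trials, times `D'`. From four trials on, the bound `3/4` and `D' ≤ 2/3 * G` just suffice. With three
trials the maximum is `8/9`, which is why `le_third` is needed. -/
theorem antitoneOn_probNone_sub (hr : IsRegular K G D') :
    AntitoneOn (fun p => probNone (K + 4) p * G - probOneOne (K + 4) p * D')
      (Set.Icc 0 (1 / 2)) := by
  have hG : 0 ≤ G := by linarith [hr.four_le]
  have hbin : ∀ p : ℝ, 0 ≤ p → p ≤ 1 / 2 →
      2 * ((K + 3) * (K + 2) * p ^ 2 * (1 - 2 * p) ^ (K + 1)) * D' ≤ (1 - p) ^ (K + 3) * G := by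
    intro p hp hp'
    have hq : 0 ≤ 1 - 2 * p := by linarith
    rcases K with _ | K
    · have h1 := hr.le_third rfl
      have h2 : 12 * (p ^ 2 * (1 - 2 * p)) * D' ≤ 12 * (p ^ 2 * (1 - 2 * p)) * (1 / 3 * G) := by
        gcongr
      have h3 : 4 * (p ^ 2 * (1 - 2 * p)) ≤ (1 - p) ^ 3 := by
        have : 0 ≤ p * ((p - (1 - 2 * p) / 2) ^ 2 + 11 / 4 * (1 - 2 * p) ^ 2) + (1 - 2 * p) ^ 3 := by
          positivity
        nlinarith
      have h4 := mul_le_mul_of_nonneg_right h3 hG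
      norm_num
      linarith
    · have h1 := eight_mul_binomial_two_le hp hq K
      rw [show p + (1 - 2 * p) = 1 - p by ring] at h1
      have h2 := mul_le_mul_of_nonneg_right h1 hG
      have h3 := mul_le_mul_of_nonneg_left hr.le_two_thirds
        (by positivity : 0 ≤ (K + 4) * (K + 3) * p ^ 2 * (1 - 2 * p) ^ (K + 2))
      push_cast
      rw [show (K : ℝ) + 1 + 3 = K + 4 by ring, show (K : ℝ) + 1 + 2 = K + 3 by ring,
        show K + 1 + 1 = K + 2 from rfl, show K + 1 + 3 = K + 4 from rfl]
      linarith
  refine antitoneOn_of_deriv_nonpos (convex_Icc 0 (1 / 2)) ?_ ?_ ?_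
  · refine Continuous.continuousOn ?_
    unfold probNone probOneOne
    fun_prop
  · refine Differentiable.differentiableOn ?_
    unfold probNone probOneOne
    fun_prop
  · rw [interior_Icc]
    intro p hp
    have hp0 : 0 ≤ p := hp.1.le
    have hq : 0 ≤ 1 - 2 * p := by linarith [hp.2]
    have h1 : HasDerivAt (fun p : ℝ => 1 - p) (-1) p := by
      simpa using (hasDerivAt_id p).const_sub 1
    have h2 : HasDerivAt (fun p : ℝ => 1 - 2 * p) (-2) p := by
      simpa using ((hasDerivAt_id p).const_mul 2).const_sub 1
    have h3 := ((h1.fun_pow (K + 4)).mul_const G).fun_sub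
      (((((hasDerivAt_id' p).fun_pow 2).const_mul (((K : ℝ) + 4) * (K + 3))).fun_mul
        (h2.fun_pow (K + 2))).mul_const D')
    have h4 : HasDerivAt (fun p => probNone (K + 4) p * G - probOneOne (K + 4) p * D')
        (-(K + 4) * ((1 - p) ^ (K + 3) * G + 2 * (K + 3) * p * (1 - 2 * p) ^ (K + 2) * D' -
          2 * ((K + 3) * (K + 2) * p ^ 2 * (1 - 2 * p) ^ (K + 1)) * D')) p := by
      have h5 : (fun p => probNone (K + 4) p * G - probOneOne (K + 4) p * D') = fun x =>
          (1 - x) ^ (K + 4) * G - ((K + 4) * (K + 3) * x ^ 2) * (1 - 2 * x) ^ (K + 2) * D' := by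
        funext x
        simp only [probNone, probOneOne]
        rw [show K + 4 - 2 = K + 2 from rfl]
        push_cast
        ring
      rw [h5]
      refine h3.congr_deriv ?_
      rw [show K + 4 - 1 = K + 3 from rfl, show K + 2 - 1 = K + 1 from rfl]
      push_cast
      ring
    rw [h4.deriv]
    have h5 := hbin p hp0 hp.2.le
    have h6 : 0 ≤ 2 * (K + 3) * p * (1 - 2 * p) ^ (K + 2) * D' := by
      have := hr.nonneg
      positivity
    have h7 : 0 ≤ (1 - p) ^ (K + 3) * G + 2 * (K + 3) * p * (1 - 2 * p) ^ (K + 2) * D' -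
          2 * ((K + 3) * (K + 2) * p ^ 2 * (1 - 2 * p) ^ (K + 1)) * D' := by linarith
    have h8 := mul_nonneg (by positivity : (0 : ℝ) ≤ K + 4) h7
    linarith

theorem probOneOne_mul_le (hr : IsRegular K G D') {p : ℝ} (hp : 0 < p) (hp' : p ≤ 1 / 2) :
    probOneOne (K + 4) p * D' ≤ 1 / 2 * (probNone (K + 4) p * G) := by
  have hz := probNone_pos (K + 4) hp'
  obtain ⟨y, hy0, hy1, -, -, -, -, -, -, -, hw⟩ := exists_odds K hp hp'
  have hW := pair_le_three_quarters K hy0.le hy1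
  have hW0 : 0 ≤ (K + 4) * (K + 3) * y ^ 2 * (1 - y) ^ (K + 2) := by
    have : 0 ≤ 1 - y := by linarith
    positivity
  have hr0 := hr.nonneg
  have hr1 := hr.le_two_thirds
  rw [hw]
  calc _ ≤ probNone (K + 4) p * (3 / 4) * (2 / 3 * G) := by gcongr
    _ = _ := by ring

/-- For `p < p'` the equations express `1 - Z` and `1 - X` through the odds ratio, whose
monotonicity gives the strict inequality `hprod`. At `p'`, which may be `1/2`, the silence
inequality is enough. -/
theorem IsStage.le_of_isStage (hr : IsRegular K G D') {p p' D E : ℝ} (h : IsStage (K + 4) G D' p D)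
    (h' : IsStage (K + 4) G D' p' E) : p' ≤ p := by
  by_contra! hlt
  have hp : p < 1 / 2 := hlt.trans_le h'.le_half
  have hD := h.increment_pos hr
  have hE := h'.increment_pos hr
  have hz := probNone_pos (K + 4) h.le_half
  have hz' := probNone_pos (K + 4) h'.le_half
  have hanti : probNone (K + 4) p' * G - probOneOne (K + 4) p' * D' ≤
      probNone (K + 4) p * G - probOneOne (K + 4) p * D' :=
    antitoneOn_probNone_sub hr ⟨h.pos.le, h.le_half⟩ ⟨h'.pos.le, h'.le_half⟩ hlt.le
  have hwz := probOneOne_mul_le hr h.pos h.le_half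
  have hzG : 0 ≤ probNone (K + 4) p * G := mul_nonneg hz.le (by linarith [hr.four_le])
  have hzz : probNone (K + 4) p' * G ≤ probNone (K + 4) p * G := by
    refine mul_le_mul_of_nonneg_right ?_ (by linarith [hr.four_le])
    have := h'.le_half
    unfold probNone
    gcongr
    linarith
  have h1 := h.transmit
  have h2 := h.silent_eq hp
  have h1' := h'.transmit
  have h2' := h'.silent_le
  obtain ⟨y, hy0, hy1, -, hyp, -, -, -, hu, hv, hw⟩ := exists_odds K h.pos h.le_half
  obtain ⟨y', hy0', hy1', -, hyp', -, -, -, hu', hv', hw'⟩ := exists_odds K h'.pos h'.le_half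
  have hyy : y < y' := by
    have := h'.le_half
    rw [hyp, hyp', div_lt_div_iff₀ (by linarith) (by linarith)]
    linarith
  have hcross := odds_ratio_cross_lt K hy0 hyy hy1'
  set Z := probNone (K + 4) p * G
  set Z' := probNone (K + 4) p' * G
  set X := probOneOne (K + 4) p * D'
  set X' := probOneOne (K + 4) p' * D'
  have e1 : 1 - Z = probNone (K + 4) p * D *
      (1 + (K + 4) * y - (K + 4) * y * (1 - y) ^ (K + 3)) := by
    rw [hu, hv] at h1
    simp only [Z]
    linear_combination -h1
  have e2 : 1 - X = probNone (K + 4) p * D *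
      (2 * ((K + 4) * y) - (K + 4) * (K + 3) * y ^ 2 * (1 - y) ^ (K + 2)) := by
    rw [hu, hw] at h2
    linear_combination -h2
  have e1' : 1 - Z' = probNone (K + 4) p' * E *
      (1 + (K + 4) * y' - (K + 4) * y' * (1 - y') ^ (K + 3)) := by
    rw [hu', hv'] at h1'
    simp only [Z']
    linear_combination -h1'
  have e2' : probNone (K + 4) p' * E *
      (2 * ((K + 4) * y') - (K + 4) * (K + 3) * y' ^ 2 * (1 - y') ^ (K + 2)) ≤ 1 - X' := by
    rw [hu', hw'] at h2'
    linarith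
  have hA : 0 < 1 + (K + 4) * y - (K + 4) * y * (1 - y) ^ (K + 3) := by
    have : (1 - y) ^ (K + 3) ≤ 1 := pow_le_one₀ (by linarith) (by linarith)
    have := mul_le_mul_of_nonneg_left this (by positivity : 0 ≤ (K + 4) * y)
    linarith
  have hZ : 0 < 1 - Z := by rw [e1]; positivity
  have hprod : (1 - Z') * (1 - X) < (1 - Z) * (1 - X') := by
    have h3 := mul_lt_mul_of_pos_left hcross (mul_pos (mul_pos hz hD) (mul_pos hz' hE))
    have h4 := mul_le_mul_of_nonneg_left e2' hZ.le
    calc (1 - Z') * (1 - X) = _ := by rw [e1', e2]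
      _ < (1 - Z) * _ := by rw [e1]; linarith
      _ ≤ _ := h4
  -- `(1 - Z') * (1 - X) - (1 - Z) * (1 - X')` equals `(Z - Z') * (Z - X) + (1 - Z) * ((Z - X) - (Z'
  -- - X'))`, so it is nonnegative, against `hprod`.
  have h5 := mul_nonneg (sub_nonneg.2 hzz) (by linarith : 0 ≤ Z - X)
  have h6 := mul_nonneg hZ.le (sub_nonneg.2 hanti)
  clear_value Z Z' X X'
  linarith

theorem IsStage.unique (hr : IsRegular K G D') {p p' D E : ℝ} (h : IsStage (K + 4) G D' p D)
    (h' : IsStage (K + 4) G D' p' E) : p = p' ∧ D = E := by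
  obtain rfl : p = p' :=
    le_antisymm (h'.le_of_isStage hr h) (h.le_of_isStage hr h')
  exact ⟨rfl, h.unique_right h'⟩

end Uniqueness

/-! ### Growth of the latency in one stage -/

section Asymptotics

variable {K : ℕ} {G D' p D : ℝ}

/-- Estimates at a stage with `K + 4` opponents, in terms of the expected number `τ` of opponents
on the second channel, given that nobody is on the first. -/
theorem IsStage.exists_estimates (hr : IsRegular K G D') (h : IsStage (K + 4) G D' p D) :
    ∃ τ : ℝ, 0 < τ ∧ (K + 4) * p ≤ τ ∧ τ ≤ (K + 4) * (2 * p) ∧ (p = 1 / 2 → τ = K + 4) ∧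
      G + D ≤ Real.exp τ ∧ τ * Real.log 2 ≤ Real.log (3 * (G + D)) ∧
      τ * D ≤ 2 * (G + D) ∧ (τ - 7 / 4) * D ≤ G ∧ (p < 1 / 2 → G + D ≤ 4 * τ * D) := by
  have hD := h.increment_pos hr
  have hz := probNone_pos (K + 4) h.le_half
  have hG4 := hr.four_le
  have h1 := h.transmit
  have h2 := h.silent_le
  have h3 := h.silent_eq
  obtain ⟨y, hy0, hy1, hylt, hyp, hpy, hyp2, hzy, hu, hv, hw⟩ := exists_odds K h.pos h.le_half
  have hW := pair_le_three_quarters K hy0.le hy1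
  have hWτ := pair_le_half_mean K hy0.le hy1
  have hl : 0 ≤ 1 - y := by linarith
  have hpow : (1 - y) ^ (K + 3) ≤ 1 := pow_le_one₀ hl (by linarith)
  have hpow0 : 0 ≤ (1 - y) ^ (K + 3) := by positivity
  have hW0 : 0 ≤ (K + 4) * (K + 3) * y ^ 2 * (1 - y) ^ (K + 2) := by positivity
  have hτ : 0 < (K + 4) * y := by positivity
  rw [hu, hv] at h1
  rw [hu, hw] at h2 h3
  have hV0 : 0 ≤ (K + 4) * y * (1 - y) ^ (K + 3) := mul_nonneg hτ.le hpow0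
  have hVτ : (K + 4) * y * (1 - y) ^ (K + 3) ≤ (K + 4) * y := mul_le_of_le_one_right hτ.le hpow
  set z := probNone (K + 4) p
  set W := (K + 4) * (K + 3) * y ^ 2 * (1 - y) ^ (K + 2)
  set V := (K + 4) * y * (1 - y) ^ (K + 3)
  refine ⟨(K + 4) * y, hτ, by gcongr, by gcongr, ?_, ?_, ?_, ?_, ?_, ?_⟩
  · intro hp
    rw [hyp, hp]
    norm_num
  · have hVD : 0 ≤ z * ((K + 4) * y - V) * D :=
      mul_nonneg (mul_nonneg hz.le (by linarith)) hD.le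
    have hzF : z * (G + D) ≤ 1 := by linarith
    have hle : G + D ≤ (1 + y) ^ (K + 4) := by
      have : z * (G + D) ≤ z * (1 + y) ^ (K + 4) := by rw [hzy]; exact hzF
      exact le_of_mul_le_mul_left this hz
    refine hle.trans ?_
    calc (1 + y) ^ (K + 4) ≤ Real.exp y ^ (K + 4) := by
          gcongr
          linarith [Real.add_one_le_exp y]
      _ = Real.exp ((K + 4) * y) := by rw [← Real.exp_nat_mul]; push_cast; rfl
  -- As `W ≤ τ / 2`, silence gives `z * τ * D ≤ 2/3`, and then transmission gives `z * (G + D) ≥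
  -- 1/3`. Bernoulli's `2 ^ y ≤ 1 + y` turns the power into `τ`.
  · have hWD' : 0 ≤ z * W * D' := mul_nonneg (mul_nonneg hz.le hW0) hr.nonneg
    have hWD : 0 ≤ z * ((K + 4) * y / 2 - W) * D :=
      mul_nonneg (mul_nonneg hz.le (by linarith)) hD.le
    have hVD : 0 ≤ z * V * D := mul_nonneg (mul_nonneg hz.le hV0) hD.le
    have hzF : 1 ≤ z * (3 * (G + D)) := by linarith
    have hle : (1 + y) ^ (K + 4) ≤ 3 * (G + D) := by
      have : z * (1 + y) ^ (K + 4) ≤ z * (3 * (G + D)) := by rw [hzy]; exact hzF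
      exact le_of_mul_le_mul_left this hz
    have hlog := Real.log_le_log (by positivity) hle
    rw [Real.log_pow] at hlog
    have hbern : (1 + 1 : ℝ) ^ y ≤ 1 + y * 1 :=
      rpow_one_add_le_one_add_mul_self (by norm_num) hy0.le hy1
    have hlog2 := Real.log_le_log (by positivity) hbern
    rw [Real.log_rpow (by norm_num), mul_one, one_add_one_eq_two] at hlog2
    have := mul_le_mul_of_nonneg_left hlog2 (by positivity : (0 : ℝ) ≤ K + 4)
    push_cast at hlog
    linarith
  · have hWD' : 0 ≤ z * W * D' := mul_nonneg (mul_nonneg hz.le hW0) hr.nonneg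
    have hWD : 0 ≤ z * ((K + 4) * y / 2 - W) * D :=
      mul_nonneg (mul_nonneg hz.le (by linarith)) hD.le
    have hVD : 0 ≤ z * V * D := mul_nonneg (mul_nonneg hz.le hV0) hD.le
    have : z * ((K + 4) * y * D) ≤ z * (2 * (G + D)) := by linarith
    exact le_of_mul_le_mul_left this hz
  -- Subtract the transmission equation from the silence inequality; `7/4` is `1` plus the bound
  -- `3/4` for `W`.
  · have hWD' : 0 ≤ z * W * D' := mul_nonneg (mul_nonneg hz.le hW0) hr.nonneg
    have hWD : 0 ≤ z * (3 / 4 - W) * D :=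
      mul_nonneg (mul_nonneg hz.le (by linarith)) hD.le
    have hVD : 0 ≤ z * V * D := mul_nonneg (mul_nonneg hz.le hV0) hD.le
    have : z * (((K + 4) * y - 7 / 4) * D) ≤ z * G := by linarith
    exact le_of_mul_le_mul_left this hz
  -- `W * D' ≤ G / 2`, so `2 * τ * D` has to supply the other half of the silence equation.
  · intro hp
    have h3 := h3 hp
    have hVD : 0 ≤ z * ((K + 4) * y - V) * D :=
      mul_nonneg (mul_nonneg hz.le (by linarith)) hD.le
    have hWD : 0 ≤ z * W * D := mul_nonneg (mul_nonneg hz.le hW0) hD.le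
    have hWD' : z * W * D' ≤ z * (3 / 4) * (2 / 3 * G) := by
      have := hr.nonneg
      have := hr.le_two_thirds
      gcongr
    have hzD := mul_pos hz hD
    have : z * (G + D) ≤ z * (4 * ((K + 4) * y) * D) := by linarith
    exact le_of_mul_le_mul_left this hz

theorem IsStage.isRegular (hr : IsRegular K G D') (h : IsStage (K + 4) G D' p D) :
    IsRegular (K + 1) (G + D) D := by
  have hD := h.increment_pos hr
  have hG4 := hr.four_le
  refine ⟨by linarith, ?_, hD.le, ?_, fun h => absurd h (Nat.succ_ne_zero K)⟩
  · have h1 := h.transmit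
    have huv := probNoneOne_le_probOne (K + 4) h.pos.le h.le_half
    have := mul_nonneg (sub_nonneg.2 huv) hD.le
    have hzF : probNone (K + 4) p * (G + D) ≤ 1 := by linarith
    have hz2 : (1 / 2 : ℝ) ^ (K + 4) ≤ probNone (K + 4) p := by
      have := h.le_half
      unfold probNone
      gcongr
      linarith
    have h5 : (1 / 2 : ℝ) ^ (K + 4) * (G + D) ≤ 1 :=
      (mul_le_mul_of_nonneg_right hz2 (by linarith)).trans hzF
    rw [one_div_pow, div_mul_eq_mul_div, one_mul, div_le_one (by positivity)] at h5
    exact h5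
  -- Otherwise `D > 2 * G` and `G + D > 12`. But then `(τ - 7/4) * D ≤ G` gives `τ < 9/4`, and `exp
  -- (9/4) < 12` because `e ^ 9 < 12 ^ 4`.
  · by_contra! hlt
    obtain ⟨τ, hτ, -, -, -, hexp, -, -, hK, -⟩ := h.exists_estimates hr
    have hτ94 : τ < 9 / 4 := by
      by_contra! hge
      have := mul_le_mul_of_nonneg_right (by linarith : 1 / 2 ≤ τ - 7 / 4) hD.le
      linarith
    have h12 : 12 < Real.exp (9 / 4) := by
      have := Real.exp_lt_exp.2 hτ94
      linarith
    have hpow : (12 : ℝ) ^ 4 < Real.exp 1 ^ 9 := by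
      have : Real.exp (9 / 4) ^ 4 = Real.exp 1 ^ 9 := by
        rw [← Real.exp_nat_mul, ← Real.exp_nat_mul]; norm_num
      rw [← this]
      gcongr
    have he : Real.exp 1 ^ 9 < (2.7182818286 : ℝ) ^ 9 := by
      have := Real.exp_one_lt_d9
      gcongr
    norm_num at hpow he
    linarith

/-- `log F - log G ≥ D / F ≥ 1 / (4 * τ)` and `τ * log 2 ≤ 2 * log F`, so `log F * (log F - log G) ≥
log 2 / 8 > 1/24`. -/
theorem log_increment_lower {F : ℝ} (hr : IsRegular K G D') (h : IsStage (K + 4) G D' p D)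
    (hF : F = G + D) (hp : p < 1 / 2) :
    Real.log G ^ 2 + 1 / 24 ≤ Real.log F ^ 2 := by
  have hD := h.increment_pos hr
  have hG4 := hr.four_le
  obtain ⟨τ, hτ, -, -, -, -, hlog, -, -, hlow⟩ := h.exists_estimates hr
  have hlow := hlow hp
  rw [← hF] at hlow hlog
  have hF0 : 0 < F := by linarith
  have hG0 : 0 < G := by linarith
  have hl2 : 0.6931471803 < Real.log 2 := Real.log_two_gt_d9
  have hLG : 0 ≤ Real.log G := Real.log_nonneg (by linarith)
  have hLF : Real.log 4 ≤ Real.log F := Real.log_le_log (by norm_num) (by linarith)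
  have hL4 : Real.log 4 = 2 * Real.log 2 := by
    rw [show (4 : ℝ) = 2 ^ 2 by norm_num, Real.log_pow]; norm_num
  have hL3 : Real.log 3 ≤ Real.log 4 := Real.log_le_log (by norm_num) (by norm_num)
  rw [Real.log_mul (by norm_num) hF0.ne'] at hlog
  have hinc : D / F ≤ Real.log F - Real.log G := by
    have := Real.one_sub_inv_le_log_of_pos (div_pos hF0 hG0)
    rw [Real.log_div hF0.ne' hG0.ne', inv_div] at this
    have e : 1 - G / F = D / F := by rw [hF] at hF0 ⊢; field_simp; ring
    linarith
  have hδ : 1 ≤ 4 * τ * (D / F) := by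
    rw [mul_div_assoc', le_div_iff₀ hF0]; linarith
  have hδ0 : 0 ≤ D / F := by positivity
  have h5 : Real.log 2 ≤ 8 * (Real.log F * (D / F)) := by
    have h6 := mul_le_mul_of_nonneg_left hδ (by linarith : 0 ≤ Real.log 2)
    have h7 := mul_le_mul_of_nonneg_right (by linarith : τ * Real.log 2 ≤ 2 * Real.log F) hδ0
    linarith
  have hLF0 : 0 ≤ Real.log F := by linarith
  have h8 := mul_le_mul_of_nonneg_left hinc hLF0
  have h9 := mul_nonneg hLG (hδ0.trans hinc)
  nlinarith

/-- `log F ≤ τ` and `τ * D ≤ 2 * F` give `log F * D ≤ 2 * F`. If `log F > 4`, then `F ≤ 2 * G`,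
hence `log F * (log F - log G) ≤ 4`, and the difference of squares is at most twice this. -/
theorem log_increment_upper {F : ℝ} (hr : IsRegular K G D') (h : IsStage (K + 4) G D' p D)
    (hF : F = G + D) : Real.log F ^ 2 ≤ 16 ∨ Real.log F ^ 2 ≤ Real.log G ^ 2 + 8 := by
  have hD := h.increment_pos hr
  have hG4 := hr.four_le
  obtain ⟨τ, hτ, -, -, -, hexp, -, hup, -, -⟩ := h.exists_estimates hr
  rw [← hF] at hup hexp
  have hF0 : 0 < F := by linarith
  have hG0 : 0 < G := by linarith
  have hLG : 0 ≤ Real.log G := Real.log_nonneg (by linarith)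
  have hLGF : Real.log G ≤ Real.log F := Real.log_le_log hG0 (by linarith)
  have hLτ : Real.log F ≤ τ := by
    have := Real.log_le_log hF0 hexp
    rwa [Real.log_exp] at this
  by_cases hL : Real.log F ≤ 4
  · left; nlinarith
  · right
    push Not at hL
    have hLD : Real.log F * D ≤ 2 * F := (mul_le_mul_of_nonneg_right hLτ hD.le).trans hup
    have h4D := mul_le_mul_of_nonneg_right hL.le hD.le
    have hFG : F ≤ 2 * G := by linarith
    have hinc : Real.log F - Real.log G ≤ D / G := by
      have := Real.log_le_sub_one_of_pos (div_pos hF0 hG0)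
      rw [Real.log_div hF0.ne' hG0.ne'] at this
      have e : F / G - 1 = D / G := by rw [hF]; field_simp; ring
      linarith
    have hLDG : Real.log F * (D / G) ≤ 4 := by
      rw [mul_div_assoc', div_le_iff₀ hG0]; linarith
    have hLF0 : 0 ≤ Real.log F := by linarith
    have h8 := mul_le_mul_of_nonneg_left hinc hLF0
    nlinarith

end Asymptotics

/-! ### The recursive sequence and its asymptotics -/

section Sequence

/-- The latency with `j + 1` pending players, and the last increment. -/
noncomputable def stageValue : ℕ → ℝ × ℝ
  -- The second entry is a convention: `probOneOne` vanishes for one opponent, so the first stage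
  -- does not see it.
  | 0 => (1, 0)
  | j + 1 =>
    let D := (exists_isStage (j + 1) (stageValue j).1 (stageValue j).2).choose_spec.choose
    ((stageValue j).1 + D, D)

/-- The equilibrium transmission probability on each channel with `m` pending players. -/
noncomputable def transmitProb (m : ℕ) : ℝ :=
  (exists_isStage (m - 1) (stageValue (m - 2)).1 (stageValue (m - 2)).2).choose

/-- The expected future latency in equilibrium with `m` pending players. -/
noncomputable def equilibriumLatency (m : ℕ) : ℝ := (stageValue (m - 1)).1

theorem equilibriumLatency_one : equilibriumLatency 1 = 1 := rfl

theorem isStage_stageValue (j : ℕ) :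
    IsStage (j + 1) (stageValue j).1 (stageValue j).2 (transmitProb (j + 2))
      (stageValue (j + 1)).2 :=
  (exists_isStage (j + 1) (stageValue j).1 (stageValue j).2).choose_spec.choose_spec

theorem stageValue_succ_fst (j : ℕ) :
    (stageValue (j + 1)).1 = (stageValue j).1 + (stageValue (j + 1)).2 := rfl

theorem stageValue_snd (j : ℕ) :
    (stageValue j).2 = equilibriumLatency (j + 1) - equilibriumLatency j := by
  cases j with
  | zero => simp [equilibriumLatency, stageValue]
  | succ j => simp [equilibriumLatency, stageValue_succ_fst]

theorem stageValue_one : transmitProb 2 = 1 / 2 ∧ stageValue 1 = (2, 1) := by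
  obtain ⟨h1, h2⟩ := (isStage_stageValue 0).of_one
  refine ⟨h1, Prod.ext ?_ h2⟩
  rw [stageValue_succ_fst, h2]
  norm_num [stageValue]

theorem stageValue_two : transmitProb 3 = 1 / 2 ∧ stageValue 2 = (8 / 3, 2 / 3) := by
  have h := isStage_stageValue 1
  rw [stageValue_one.2] at h
  obtain ⟨h1, h2⟩ := h.of_two
  refine ⟨h1, Prod.ext ?_ h2⟩
  rw [stageValue_succ_fst, h2, stageValue_one.2]
  norm_num

theorem stageValue_three : transmitProb 4 = 1 / 2 ∧ stageValue 3 = (4, 4 / 3) := by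
  have h := isStage_stageValue 2
  rw [stageValue_two.2] at h
  obtain ⟨h1, h2⟩ := h.of_three
  refine ⟨h1, Prod.ext ?_ h2⟩
  rw [stageValue_succ_fst, h2, stageValue_two.2]
  norm_num

theorem isRegular_stageValue (K : ℕ) :
    IsRegular K (stageValue (K + 3)).1 (stageValue (K + 3)).2 := by
  induction K with
  | zero =>
    rw [stageValue_three.2]
    exact ⟨le_rfl, by norm_num, by norm_num, by norm_num, fun _ => by norm_num⟩
  | succ K ih => exact (isStage_stageValue (K + 3)).isRegular ih

theorem isStage_stageValue_unique (j : ℕ) {p D : ℝ}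
    (h : IsStage (j + 1) (stageValue j).1 (stageValue j).2 p D) :
    p = transmitProb (j + 2) ∧ D = (stageValue (j + 1)).2 := by
  rcases j with _ | _ | _ | K
  · obtain ⟨h1, h2⟩ := h.of_one
    rw [stageValue_one.1, stageValue_one.2]
    exact ⟨h1, h2⟩
  · rw [stageValue_one.2] at h
    obtain ⟨h1, h2⟩ := h.of_two
    rw [stageValue_two.1, stageValue_two.2]
    exact ⟨h1, h2⟩
  · rw [stageValue_two.2] at h
    obtain ⟨h1, h2⟩ := h.of_three
    rw [stageValue_three.1, stageValue_three.2]
    exact ⟨h1, h2⟩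
  · exact h.unique (isRegular_stageValue K) (isStage_stageValue (K + 3))

theorem stageValue_snd_nonneg (j : ℕ) : 0 ≤ (stageValue j).2 := by
  rcases j with _ | _ | _ | K
  · exact le_rfl
  · rw [stageValue_one.2]; norm_num
  · rw [stageValue_two.2]; norm_num
  · exact (isRegular_stageValue K).nonneg

theorem one_le_stageValue_fst (j : ℕ) : 1 ≤ (stageValue j).1 := by
  induction j with
  | zero => exact le_rfl
  | succ j ih => rw [stageValue_succ_fst]; linarith [stageValue_snd_nonneg (j + 1)]

theorem two_le_stageValue_succ_fst (j : ℕ) : 2 ≤ (stageValue (j + 1)).1 := by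
  induction j with
  | zero => rw [stageValue_one.2]
  | succ j ih => rw [stageValue_succ_fst]; linarith [stageValue_snd_nonneg (j + 2)]

theorem two_thirds_le_log_stageValue (j : ℕ) : 2 / 3 ≤ Real.log (stageValue (j + 1)).1 := by
  have := Real.log_le_log (by norm_num) (two_le_stageValue_succ_fst j)
  linarith [Real.log_two_gt_d9]

theorem log_stageValue_sq_lower (j : ℕ) :
    (j + 2 : ℝ) / 24 ≤ Real.log (stageValue (j + 1)).1 ^ 2 := by
  have hsmall : ∀ j : ℕ, (j : ℝ) ≤ 6 → (j + 2 : ℝ) / 24 ≤ Real.log (stageValue (j + 1)).1 ^ 2 := by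
    intro j hj
    nlinarith [two_thirds_le_log_stageValue j]
  rcases j with _ | _ | K
  · exact hsmall 0 (by norm_num)
  · exact hsmall 1 (by norm_num)
  induction K with
  | zero => exact hsmall 2 (by norm_num)
  | succ K ih =>
    have hr := isRegular_stageValue K
    have h := isStage_stageValue (K + 3)
    rcases h.le_half.lt_or_eq with hp | hp
    · have := log_increment_lower hr h (stageValue_succ_fst _) hp
      push_cast at ih ⊢
      linarith
    -- At `p = 1/2` one has `τ = K + 4`, so `log F` is bounded below linearly, without induction.
    · obtain ⟨τ, -, -, -, hτ, -, hlog, -⟩ := h.exists_estimates hr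
      rw [← stageValue_succ_fst, hτ hp] at hlog
      have h2 := two_le_stageValue_succ_fst (K + 3)
      rw [Real.log_mul (by norm_num) (by linarith)] at hlog
      have hl2 := Real.log_two_gt_d9
      have hl3 : Real.log 3 ≤ 2 * Real.log 2 := by
        have h34 : Real.log 3 ≤ Real.log 4 := Real.log_le_log (by norm_num) (by norm_num)
        rwa [show (4 : ℝ) = 2 ^ 2 by norm_num, Real.log_pow, Nat.cast_ofNat] at h34
      have hK : (0 : ℝ) ≤ K := Nat.cast_nonneg K
      have hlow : 2 / 3 * (K + 2 : ℝ) ≤ Real.log (stageValue (K + 3 + 1)).1 := by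
        have := mul_le_mul_of_nonneg_left hl2.le (by positivity : (0 : ℝ) ≤ K + 2)
        linarith
      have hsq := pow_le_pow_left₀ (by positivity) hlow 2
      push_cast
      refine le_trans ?_ hsq
      nlinarith

theorem log_stageValue_sq_upper (j : ℕ) :
    Real.log (stageValue (j + 1)).1 ^ 2 ≤ 16 * (j + 2) := by
  suffices Real.log (stageValue (j + 1)).1 ^ 2 ≤ 16 + 8 * j by
    have : (0 : ℝ) ≤ j := Nat.cast_nonneg j
    linarith
  have hsmall : ∀ j : ℕ, (stageValue (j + 1)).1 ≤ 4 →
      Real.log (stageValue (j + 1)).1 ^ 2 ≤ 16 + 8 * j := by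
    intro j hj
    have h1 := two_thirds_le_log_stageValue j
    have h2 := Real.log_le_sub_one_of_pos (by linarith [two_le_stageValue_succ_fst j] :
      0 < (stageValue (j + 1)).1)
    have : (0 : ℝ) ≤ j := Nat.cast_nonneg j
    nlinarith
  rcases j with _ | _ | K
  · exact hsmall 0 (by rw [stageValue_one.2]; norm_num)
  · exact hsmall 1 (by rw [stageValue_two.2]; norm_num)
  induction K with
  | zero => exact hsmall 2 (by rw [stageValue_three.2])
  | succ K ih =>
    have hK : (0 : ℝ) ≤ K := Nat.cast_nonneg K
    push_cast at ih ⊢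
    rcases log_increment_upper (isRegular_stageValue K) (isStage_stageValue (K + 3))
      (stageValue_succ_fst _) with h | h <;> linarith

theorem log_stageValue_lower (j : ℕ) :
    1 / 5 * √(j + 2 : ℝ) ≤ Real.log (stageValue (j + 1)).1 := by
  have h0 := two_thirds_le_log_stageValue j
  have hj : (0 : ℝ) ≤ j + 2 := by positivity
  refine abs_le_of_sq_le_sq' ?_ (by linarith) |>.2
  rw [mul_pow, Real.sq_sqrt hj]
  linarith [log_stageValue_sq_lower j]

theorem log_stageValue_upper (j : ℕ) :
    Real.log (stageValue (j + 1)).1 ≤ 4 * √(j + 2 : ℝ) := by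
  have hj : (0 : ℝ) ≤ j + 2 := by positivity
  refine abs_le_of_sq_le_sq' ?_ (by positivity) |>.2
  rw [mul_pow, Real.sq_sqrt hj]
  linarith [log_stageValue_sq_upper j]

/-- `τ` lies between `(K + 4) * p` and its double, and between `log F` and `3 * log F`. The
constants leave room for `K + 4` opponents against `K + 5` players. -/
theorem transmitProb_bounds (j : ℕ) : 1 / 10 / √(j + 2 : ℝ) ≤ transmitProb (j + 2) ∧
    transmitProb (j + 2) ≤ 16 / √(j + 2 : ℝ) := by
  have hj : (0 : ℝ) ≤ j := Nat.cast_nonneg j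
  have hs : 0 < √(j + 2 : ℝ) := Real.sqrt_pos.2 (by linarith)
  have hs1 : 1 ≤ √(j + 2 : ℝ) := Real.one_le_sqrt.2 (by linarith)
  have hsq : √(j + 2 : ℝ) ^ 2 = j + 2 := Real.sq_sqrt (by linarith)
  rw [div_le_iff₀ hs, le_div_iff₀ hs]
  have hsmall : ∀ p : ℝ, p = 1 / 2 → (j : ℝ) ≤ 6 →
      1 / 10 ≤ p * √(j + 2 : ℝ) ∧ p * √(j + 2 : ℝ) ≤ 16 := by
    intro p hp hj6
    subst hp
    constructor <;> nlinarith
  rcases j with _ | _ | _ | K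
  · exact hsmall _ stageValue_one.1 (by norm_num)
  · exact hsmall _ stageValue_two.1 (by norm_num)
  · exact hsmall _ stageValue_three.1 (by norm_num)
  · have hr := isRegular_stageValue K
    have h := isStage_stageValue (K + 3)
    obtain ⟨τ, hτ0, hτ1, hτ2, -, hexp, hlog, -⟩ := h.exists_estimates hr
    rw [← stageValue_succ_fst] at hexp hlog
    have h2 := two_le_stageValue_succ_fst (K + 3)
    have hlow := log_stageValue_lower (K + 3)
    have hup := log_stageValue_upper (K + 3)
    have hLτ : Real.log (stageValue (K + 3 + 1)).1 ≤ τ := by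
      have := Real.log_le_log (by linarith) hexp
      rwa [Real.log_exp] at this
    rw [Real.log_mul (by norm_num) (by linarith)] at hlog
    have hl2 := Real.log_two_gt_d9
    have hl3 : Real.log 3 ≤ 2 * Real.log 2 := by
      have h34 : Real.log 3 ≤ Real.log 4 := Real.log_le_log (by norm_num) (by norm_num)
      rwa [show (4 : ℝ) = 2 ^ 2 by norm_num, Real.log_pow, Nat.cast_ofNat] at h34
    have hL4 : 2 * Real.log 2 ≤ Real.log (stageValue (K + 3 + 1)).1 := by
      have h4 := (isRegular_stageValue (K + 1)).four_le
      have := Real.log_le_log (by norm_num) h4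
      rwa [show (4 : ℝ) = 2 ^ 2 by norm_num, Real.log_pow, Nat.cast_ofNat] at this
    have hτL : τ ≤ 3 * Real.log (stageValue (K + 3 + 1)).1 := by nlinarith
    rw [show K + 1 + 1 + 1 + 2 = K + 3 + 2 from rfl]
    have hp := h.pos
    push_cast at hlow hup hsq hs hs1 ⊢
    rw [show (K : ℝ) + 1 + 1 + 1 + 2 = K + 3 + 2 by ring] at *
    have hK : (0 : ℝ) ≤ K := Nat.cast_nonneg K
    set s := √((K : ℝ) + 3 + 2)
    set p := transmitProb (K + 3 + 2)
    constructor
    · have h5 : s ≤ 10 * p * s ^ 2 := by rw [hsq]; nlinarith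
      nlinarith
    · have h5 : p * s ^ 2 ≤ 16 * s := by rw [hsq]; nlinarith
      nlinarith

end Sequence

/-! ### Stages and equilibria correspond -/

section Bellman

/-- A player who is best responding to her own rule uses the two channels with the same
probability, and this probability solves the equations of the stage. -/
theorem isStage_of_bellman {N : ℕ} (hN : 1 ≤ N) {a b d f D D' A₀ A₁ A₂ : ℝ} (ha : 0 ≤ a)
    (hb : 0 ≤ b) (hd : 0 ≤ d) (hsum : a + b + d = 1) (hD' : 0 ≤ D')
    (h₀ : A₀ = f - f * (1 - a) ^ N - D * (N * b * (1 - b) ^ (N - 1)) + D * (N * b * d ^ (N - 1)))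
    (h₁ : A₁ = f - f * (1 - b) ^ N - D * (N * a * (1 - a) ^ (N - 1)) + D * (N * a * d ^ (N - 1)))
    (h₂ : A₂ = f - D * (N * a * (1 - a) ^ (N - 1)) - D * (N * b * (1 - b) ^ (N - 1)) +
      (D - D') * (N * (N - 1 : ℝ) * a * b * d ^ (N - 2)))
    (hf : 1 ≤ f) (hle₀ : f ≤ 1 + A₀) (hle₁ : f ≤ 1 + A₁) (hle₂ : f ≤ 1 + A₂)
    (heq : f = 1 + (a * A₀ + b * A₁ + d * A₂)) : a = b ∧ IsStage N (f - D) D' a D := by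
  have hs₀ := mul_nonneg ha (sub_nonneg.2 hle₀)
  have hs₁ := mul_nonneg hb (sub_nonneg.2 hle₁)
  have hs₂ := mul_nonneg hd (sub_nonneg.2 hle₂)
  -- Complementary slackness: nonnegative slacks with weighted sum zero, so every action in use has
  -- slack zero.
  have htot : a * (1 + A₀ - f) + b * (1 + A₁ - f) + d * (1 + A₂ - f) = 0 := by
    linear_combination (1 - f) * hsum - heq
  have hz₀ : 0 < a → 1 + A₀ - f = 0 := fun h =>
    (mul_eq_zero.1 (by linarith : a * (1 + A₀ - f) = 0)).resolve_left h.ne'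
  have hz₁ : 0 < b → 1 + A₁ - f = 0 := fun h =>
    (mul_eq_zero.1 (by linarith : b * (1 + A₁ - f) = 0)).resolve_left h.ne'
  have hz₂ : 0 < d → 1 + A₂ - f = 0 := fun h =>
    (mul_eq_zero.1 (by linarith : d * (1 + A₂ - f) = 0)).resolve_left h.ne'
  -- If one channel were never used, transmitting on it would surely succeed and `f = 1`; but the
  -- channel in use fails with positive probability.
  have hcorner : ∀ x : ℝ, 0 < x → x ≤ 1 → f ≤ 1 → f * (1 - x) ^ N = 1 → False := by
    intro x hx hx1 hf1 h
    have h1 : (1 - x) ^ N < 1 := pow_lt_one₀ (by linarith) (by linarith) (by omega)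
    have h2 : f = 1 := le_antisymm hf1 hf
    rw [h2, one_mul] at h
    exact h1.ne h
  have hab : ¬ b < a := by
    intro hlt
    have ha0 : 0 < a := hb.trans_lt hlt
    have e₀ := hz₀ ha0
    rcases hb.eq_or_lt with hb0 | hb0
    · rw [← hb0] at h₀ h₁ hsum
      have hda : d = 1 - a := by linarith
      rw [hda] at h₁
      simp only [sub_zero, one_pow, mul_one, mul_zero, zero_mul] at h₀ h₁
      exact hcorner a ha0 (by linarith) (by linarith) (by linarith)
    · have e₁ := hz₁ hb0
      exact not_lt_of_indifferent (f := f) (D := D) hN hb0 hd hsum (by linarith) hD' (by linarith)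
        (by linarith) hlt
  have hba : ¬ a < b := by
    intro hlt
    have hb0 : 0 < b := ha.trans_lt hlt
    have e₁ := hz₁ hb0
    rcases ha.eq_or_lt with ha0 | ha0
    · rw [← ha0] at h₀ h₁ hsum
      have hdb : d = 1 - b := by linarith
      rw [hdb] at h₀
      simp only [sub_zero, one_pow, mul_one, mul_zero, zero_mul] at h₀ h₁
      exact hcorner b hb0 (by linarith) (by linarith) (by linarith)
    · have e₀ := hz₀ ha0
      exact not_lt_of_indifferent (f := f) (D := D) hN ha0 hd (by linarith) (by linarith) hD' (by linarith)
        (by linarith) hlt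
  obtain rfl : a = b := le_antisymm (not_lt.1 hab) (not_lt.1 hba)
  have hd2 : d = 1 - 2 * a := by linarith
  subst hd2
  -- If everybody stayed silent, the state would never change, and silence would cost `1 + f`
  -- instead of `f`.
  have ha0 : 0 < a := by
    rcases ha.eq_or_lt with h | h
    · have e₂ := hz₂ (by rw [← h]; norm_num)
      rw [← h] at h₂
      simp at h₂
      linarith
    · exact h
  have e₀ := hz₀ ha0
  refine ⟨rfl, ha0, by linarith, ?_, ?_, ?_⟩
  · unfold probNone probOne probNoneOne
    linarith
  · unfold probOne probOneOne
    linarith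
  · intro hlt
    have e₂ := hz₂ (by linarith)
    unfold probOne probOneOne
    linarith

theorem toReal_one_add_sum (ν : PMF (Action 2)) (A : Action 2 → ℝ≥0∞) (hA : ∀ c, A c ≠ ⊤) :
    (1 + ∑ c, ν c * A c).toReal = 1 + ((ν (some 0)).toReal * (A (some 0)).toReal +
      (ν (some 1)).toReal * (A (some 1)).toReal + (ν none).toReal * (A none).toReal) := by
  have h : ∀ c, ν c * A c ≠ ⊤ := fun c => ENNReal.mul_ne_top (ν.apply_ne_top c) (hA c)
  rw [sum_action_two, ENNReal.toReal_add ENNReal.one_ne_top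
      (ENNReal.add_ne_top.2 ⟨ENNReal.add_ne_top.2 ⟨h _, h _⟩, h _⟩),
    ENNReal.toReal_add (ENNReal.add_ne_top.2 ⟨h _, h _⟩) (h _), ENNReal.toReal_add (h _) (h _)]
  simp

theorem toReal_pmf_action_two (ν : PMF (Action 2)) :
    (ν (some 0)).toReal + (ν (some 1)).toReal + (ν none).toReal = 1 := by
  have h := fun c => ν.apply_ne_top c
  rw [← ENNReal.toReal_add (h _) (h _), ← ENNReal.toReal_add
    (ENNReal.add_ne_top.2 ⟨h _, h _⟩) (h _), pmf_action_two, ENNReal.toReal_one]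

theorem actionValue_one_some (q : ℕ → PMF (Action 2)) (G : ℕ → ℝ≥0∞) (a : Fin 2) :
    actionValue q G 1 (some a) = 0 := by
  fin_cases a <;> simp [actionValue, countExp, outcome]

theorem actionValue_one_none (q : ℕ → PMF (Action 2)) (G : ℕ → ℝ≥0∞) :
    actionValue q G 1 none = G 1 := by
  simp [actionValue, countExp, outcome]

variable {n : ℕ} {q : ℕ → PMF (Action 2)}

theorem IsAnonymousEquilibrium.latency_one (hq : IsAnonymousEquilibrium n q) (hn : 1 ≤ n) :
    latency q q 1 = 1 ∧ q 1 none = 0 := by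
  have h1 := hq.latency_le_one_add le_rfl hn (some 0)
  rw [actionValue_one_some, add_zero] at h1
  have h2 := latency_eq q q 1
  rw [sum_action_two, actionValue_one_some, actionValue_one_some, actionValue_one_none] at h2
  simp only [mul_zero, zero_add] at h2
  have h3 : latency q q 1 = 1 := le_antisymm h1 (by rw [h2]; exact le_self_add)
  refine ⟨h3, ?_⟩
  rw [h3, mul_one] at h2
  have h4 : (1 : ℝ≥0∞) + 0 = 1 + q 1 none := by rw [add_zero]; exact h2
  exact ((ENNReal.add_right_inj ENNReal.one_ne_top).1 h4).symm

theorem IsAnonymousEquilibrium.stage (hq : IsAnonymousEquilibrium n q) (j : ℕ)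
    (hj : j + 2 ≤ n) (h1 : (latency q q (j + 1)).toReal = equilibriumLatency (j + 1))
    (h0 : 1 ≤ j → (latency q q j).toReal = equilibriumLatency j) :
    (latency q q (j + 2)).toReal = equilibriumLatency (j + 2) ∧
      ∀ a, (q (j + 2) (some a)).toReal = transmitProb (j + 2) := by
  -- State `0` is out of reach for a pending player. The value `1` there agrees with
  -- `equilibriumLatency 0`, so that the increment entering the first stage is `0`.
  let G : ℕ → ℝ≥0∞ := fun l => if l = 0 then 1 else latency q q l
  have hG : ∀ l, 1 ≤ l → G l = latency q q l := fun l hl => if_neg (by omega)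
  have hGtop : ∀ l, 1 ≤ l → l ≤ j + 1 + 1 → G l ≠ ⊤ := fun l h1 h2 => by
    rw [hG l h1]; exact hq.latency_ne_top h1 (by omega)
  have hcongr : ∀ c, actionValue q (latency q q) (j + 2) c = actionValue q G (j + 2) c :=
    fun c => actionValue_congr q (by omega) (fun l hl _ => (hG l hl).symm) c
  have hAtop : ∀ c, actionValue q G (j + 2) c ≠ ⊤ := fun c =>
    actionValue_ne_top (by omega) hGtop c
  have hbell := latency_eq q q (j + 2)
  simp only [hcongr] at hbell
  have hle : ∀ c, latency q q (j + 2) ≤ 1 + actionValue q G (j + 2) c := fun c => by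
    rw [← hcongr]; exact hq.latency_le_one_add (by omega) hj c
  have hle' : ∀ c, (latency q q (j + 2)).toReal ≤ 1 + (actionValue q G (j + 2) c).toReal := by
    intro c
    have := ENNReal.toReal_mono (ENNReal.add_ne_top.2 ⟨ENNReal.one_ne_top, hAtop c⟩) (hle c)
    rwa [ENNReal.toReal_add ENNReal.one_ne_top (hAtop c), ENNReal.toReal_one] at this
  have hreal := congrArg ENNReal.toReal hbell
  rw [toReal_one_add_sum _ _ hAtop] at hreal
  set f := (latency q q (j + 2)).toReal with hf
  have hGf : (G (j + 1 + 1)).toReal = f := by rw [hG _ (by omega)]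
  have hGD : (G (j + 1)).toReal = f - (f - equilibriumLatency (j + 1)) := by
    rw [hG _ (by omega), h1]; ring
  have hGD' : (G (j + 1 - 1)).toReal =
      f - (f - equilibriumLatency (j + 1)) - (stageValue j).2 := by
    rw [stageValue_snd, Nat.add_sub_cancel]
    rcases Nat.eq_zero_or_pos j with hj0 | hj0
    · subst hj0
      simp [G, equilibriumLatency, stageValue]
    · rw [hG j hj0, h0 hj0]; ring
  have hsum := toReal_pmf_action_two (q (j + 2))
  have hf1 : 1 ≤ f := by
    rw [hreal]
    have : 0 ≤ (q (j + 2) (some 0)).toReal * (actionValue q G (j + 2) (some 0)).toReal +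
      (q (j + 2) (some 1)).toReal * (actionValue q G (j + 2) (some 1)).toReal +
      (q (j + 2) none).toReal * (actionValue q G (j + 2) none).toReal := by positivity
    linarith
  obtain ⟨hab, hst⟩ := isStage_of_bellman (N := j + 1) (by omega) ENNReal.toReal_nonneg
    ENNReal.toReal_nonneg ENNReal.toReal_nonneg hsum (stageValue_snd_nonneg j)
    (toReal_actionValue_zero hGtop rfl rfl rfl hsum hGf hGD)
    (toReal_actionValue_one hGtop rfl rfl rfl hsum hGf hGD)
    (toReal_actionValue_none hGtop rfl rfl rfl hsum hGf hGD hGD') hf1 (hle' _) (hle' _) (hle' _)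
    hreal
  rw [sub_sub_cancel] at hst
  obtain ⟨hp, hD⟩ := isStage_stageValue_unique j hst
  constructor
  · have h3 : equilibriumLatency (j + 2) = equilibriumLatency (j + 1) + (stageValue (j + 1)).2 :=
      stageValue_succ_fst j
    linarith
  · intro a
    fin_cases a
    · exact hp
    · exact hab.symm.trans hp

theorem IsAnonymousEquilibrium.toReal_latency (hq : IsAnonymousEquilibrium n q) (m : ℕ)
    (h1 : 1 ≤ m) (hm : m ≤ n) : (latency q q m).toReal = equilibriumLatency m := by
  induction m using Nat.strong_induction_on with
  | _ m ih =>
    rcases m with _ | _ | j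
    · omega
    · rw [(hq.latency_one hm).1, equilibriumLatency_one, ENNReal.toReal_one]
    · exact (hq.stage j hm (ih _ (by omega) (by omega) (by omega))
        fun hj => ih _ (by omega) hj (by omega)).1

theorem IsAnonymousEquilibrium.latency_eq_ofReal (hq : IsAnonymousEquilibrium n q) (m : ℕ)
    (h1 : 1 ≤ m) (hm : m ≤ n) : latency q q m = ENNReal.ofReal (equilibriumLatency m) := by
  rw [← hq.toReal_latency m h1 hm, ENNReal.ofReal_toReal (hq.latency_ne_top h1 hm)]

theorem IsAnonymousEquilibrium.apply_some (hq : IsAnonymousEquilibrium n q) (m : ℕ)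
    (h2 : 2 ≤ m) (hm : m ≤ n) (a : Fin 2) :
    q m (some a) = ENNReal.ofReal (transmitProb m) := by
  obtain ⟨j, rfl⟩ := Nat.exists_eq_add_of_le' h2
  rw [← (hq.stage j hm (hq.toReal_latency _ (by omega) (by omega))
    fun hj => hq.toReal_latency _ hj (by omega)).2 a,
    ENNReal.ofReal_toReal ((q _).apply_ne_top _)]

theorem one_le_equilibriumLatency (m : ℕ) : 1 ≤ equilibriumLatency m := one_le_stageValue_fst _

/-- Converse to `isStage_of_bellman`: the stage conditions are rearranged into optimality of the
actions in use. -/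
theorem toReal_actionValue_of_apply (j : ℕ)
    (hq : ∀ a, q (j + 2) (some a) = ENNReal.ofReal (transmitProb (j + 2))) :
    (∀ a, 1 + (actionValue q (fun m => ENNReal.ofReal (equilibriumLatency m)) (j + 2)
        (some a)).toReal = equilibriumLatency (j + 2)) ∧
      equilibriumLatency (j + 2) ≤ 1 + (actionValue q
        (fun m => ENNReal.ofReal (equilibriumLatency m)) (j + 2) none).toReal ∧
      (0 < (q (j + 2) none).toReal → 1 + (actionValue q
        (fun m => ENNReal.ofReal (equilibriumLatency m)) (j + 2) none).toReal =
          equilibriumLatency (j + 2)) := by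
  have h := isStage_stageValue j
  have hp := h.pos
  have hsum := toReal_pmf_action_two (q (j + 2))
  set G : ℕ → ℝ≥0∞ := fun m => ENNReal.ofReal (equilibriumLatency m)
  have hGr : ∀ m, (G m).toReal = equilibriumLatency m := fun m =>
    ENNReal.toReal_ofReal (by linarith [one_le_equilibriumLatency m])
  have hGtop : ∀ l, 1 ≤ l → l ≤ j + 1 + 1 → G l ≠ ⊤ := fun _ _ _ => ENNReal.ofReal_ne_top
  have hqa : ∀ a, (q (j + 1 + 1) (some a)).toReal = transmitProb (j + 2) := fun a => by
    rw [hq, ENNReal.toReal_ofReal hp.le]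
  have hsucc : equilibriumLatency (j + 2) = equilibriumLatency (j + 1) + (stageValue (j + 1)).2 :=
    stageValue_succ_fst j
  have hG1 : (G (j + 1)).toReal = equilibriumLatency (j + 2) - (stageValue (j + 1)).2 := by
    rw [hGr, hsucc]; ring
  have hG0 : (G (j + 1 - 1)).toReal =
      equilibriumLatency (j + 2) - (stageValue (j + 1)).2 - (stageValue j).2 := by
    rw [hGr, hsucc, stageValue_snd j, Nat.add_sub_cancel]; ring
  have hd : (q (j + 1 + 1) none).toReal = 1 - 2 * transmitProb (j + 2) := by
    have h0 := hqa 0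
    have h1 := hqa 1
    rw [show j + 1 + 1 = j + 2 from rfl] at *
    linarith
  have hsum' : transmitProb (j + 2) + transmitProb (j + 2) + (1 - 2 * transmitProb (j + 2)) = 1 := by
    ring
  have e₀ := toReal_actionValue_zero hGtop (hqa 0) (hqa 1) hd hsum' (hGr _) hG1
  have e₁ := toReal_actionValue_one hGtop (hqa 0) (hqa 1) hd hsum' (hGr _) hG1
  have e₂ := toReal_actionValue_none hGtop (hqa 0) (hqa 1) hd hsum' (hGr _) hG1 hG0
  have ht := h.transmit
  have hle := h.silent_le
  have heq := h.silent_eq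
  have hfst : (stageValue j).1 = equilibriumLatency (j + 1) := rfl
  unfold probNone probOne probNoneOne at ht
  unfold probOne probOneOne at hle heq
  rw [hfst, ← hsucc] at ht
  rw [show j + 1 + 1 = j + 2 from rfl] at *
  refine ⟨fun a => ?_, by linarith, fun h0 => ?_⟩
  · fin_cases a
    · simp only [Fin.zero_eta]; linarith
    · simp only [Fin.mk_one]; linarith
  · have := heq (by linarith)
    linarith

theorem isAnonymousEquilibrium_of_apply (h1 : q 1 none = 0)
    (hq : ∀ m, 2 ≤ m → m ≤ n → ∀ a, q m (some a) = ENNReal.ofReal (transmitProb m)) :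
    IsAnonymousEquilibrium n q := by
  set G : ℕ → ℝ≥0∞ := fun m => ENNReal.ofReal (equilibriumLatency m) with hG
  have hGr : ∀ m, (G m).toReal = equilibriumLatency m := fun m =>
    ENNReal.toReal_ofReal (by linarith [one_le_equilibriumLatency m])
  have hGtop : ∀ m, G m ≠ ⊤ := fun _ => ENNReal.ofReal_ne_top
  have hG1 : G 1 = 1 := by simp [hG, equilibriumLatency_one]
  have hAtop : ∀ j c, actionValue q G (j + 2) c ≠ ⊤ := fun j c =>
    actionValue_ne_top (by omega) (fun l _ _ => hGtop l) c
  refine (isAnonymousEquilibrium_of_bellman q G (fun m _ _ => hGtop m) ?_ ?_).1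
  · intro m hm hmn c
    rcases m with _ | _ | j
    · omega
    · rw [hG1]; exact le_self_add
    · obtain ⟨hs, hn, -⟩ := toReal_actionValue_of_apply j (hq (j + 2) (by omega) hmn)
      rw [← ENNReal.toReal_le_toReal (hGtop _)
        (ENNReal.add_ne_top.2 ⟨ENNReal.one_ne_top, hAtop j c⟩),
        ENNReal.toReal_add ENNReal.one_ne_top (hAtop j c), ENNReal.toReal_one, hGr]
      rcases c with _ | a
      · exact hn
      · exact (hs a).ge
  · intro m hm hmn
    rcases m with _ | _ | j
    · omega
    · rw [hG1, sum_action_two, actionValue_one_some, actionValue_one_some, h1]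
      simp
    · obtain ⟨hs, -, hn⟩ := toReal_actionValue_of_apply j (hq (j + 2) (by omega) hmn)
      have hsum := toReal_pmf_action_two (q (j + 2))
      have hfin : 1 + ∑ c, q (j + 2) c * actionValue q G (j + 2) c ≠ ⊤ := by
        refine ENNReal.add_ne_top.2 ⟨ENNReal.one_ne_top, ?_⟩
        rw [ENNReal.sum_ne_top]
        exact fun c _ => ENNReal.mul_ne_top ((q _).apply_ne_top c) (hAtop j c)
      rw [show j + 1 + 1 = j + 2 from rfl, ← ENNReal.toReal_eq_toReal_iff' (hGtop _) hfin,
        toReal_one_add_sum _ _ (hAtop j), hGr]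
      have e0 := hs 0
      have e1 := hs 1
      have hnone : (q (j + 2) none).toReal * (1 + (actionValue q G (j + 2) none).toReal) =
          (q (j + 2) none).toReal * equilibriumLatency (j + 2) := by
        rcases (ENNReal.toReal_nonneg (a := q (j + 2) none)).eq_or_lt with h0 | h0
        · rw [← h0, zero_mul, zero_mul]
        · rw [hn h0]
      linear_combination (equilibriumLatency (j + 2) - 1) * (-hsum) -
        (q (j + 2) (some 0)).toReal * e0 - (q (j + 2) (some 1)).toReal * e1 - hnone

/-- The action of a player who uses each of the two channels with probability `p`. -/
noncomputable def symmetricAction (p : ℝ) (hp : 0 ≤ p) (hp' : p ≤ 1 / 2) : PMF (Action 2) :=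
  PMF.ofFintype (fun c => if c = none then ENNReal.ofReal (1 - 2 * p) else ENNReal.ofReal p) (by
    rw [sum_action_two]
    simp only [reduceCtorEq, if_false, if_true]
    rw [← ENNReal.ofReal_add hp hp, ← ENNReal.ofReal_add (by linarith) (by linarith)]
    rw [show p + p + (1 - 2 * p) = 1 by ring, ENNReal.ofReal_one])

theorem exists_isAnonymousEquilibrium (n : ℕ) :
    ∃ q : ℕ → PMF (Action 2), IsAnonymousEquilibrium n q := by
  have hst : ∀ m, 0 ≤ transmitProb m ∧ transmitProb m ≤ 1 / 2 := fun m =>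
    let h := (exists_isStage (m - 1) (stageValue (m - 2)).1
      (stageValue (m - 2)).2).choose_spec.choose_spec
    ⟨h.pos.le, h.le_half⟩
  refine ⟨fun m => if m = 1 then PMF.pure (some 0)
    else symmetricAction (transmitProb m) (hst m).1 (hst m).2,
    isAnonymousEquilibrium_of_apply ?_ fun m hm _ a => ?_⟩
  · simp [PMF.pure_apply]
  · simp [show m ≠ 1 by omega, symmetricAction]

end Bellman
end Contention

theorem mainTheorem1 :
    ∃ (p : ℕ → ℝ) (c C : ℝ), 0 < c ∧ 0 < C ∧
      (∀ m : ℕ, 2 ≤ m → c / √(m : ℝ) ≤ p m ∧ p m ≤ C / √(m : ℝ)) ∧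
      ∀ n : ℕ, 2 ≤ n →
        (∃ q : ℕ → PMF (Contention.Action 2), Contention.IsAnonymousEquilibrium n q) ∧
        (∀ q : ℕ → PMF (Contention.Action 2), Contention.IsAnonymousEquilibrium n q ↔
          q 1 none = 0 ∧
            ∀ m : ℕ, 2 ≤ m → m ≤ n → ∀ a : Fin 2, q m (some a) = ENNReal.ofReal (p m)) ∧
        (∀ q : ℕ → PMF (Contention.Action 2), Contention.IsAnonymousEquilibrium n q →
          ∀ (h : Contention.History n 2) (i : Fin n), i ∈ Contention.pending h →
            2 ≤ (Contention.pending h).card →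
            ENNReal.ofReal (Real.exp (c * √((Contention.pending h).card : ℝ))) ≤
                Contention.futureLatency (fun _ : Fin n => Contention.historyIndependent q) h i ∧
              Contention.futureLatency (fun _ : Fin n => Contention.historyIndependent q) h i ≤
                ENNReal.ofReal (Real.exp (C * √((Contention.pending h).card : ℝ)))) := by
  -- The constants are those of `transmitProb_bounds`; the latency bounds hold even with `1 / 5` and
  -- `4`.
  refine ⟨Contention.transmitProb, 1 / 10, 16, by norm_num, by norm_num, fun m hm => ?_,
    fun n hn => ⟨Contention.exists_isAnonymousEquilibrium n, fun q => ⟨fun hq => ?_, fun hq => ?_⟩,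
      fun q hq h i hi hcard => ?_⟩⟩
  · obtain ⟨j, rfl⟩ := Nat.exists_eq_add_of_le' hm
    have := Contention.transmitProb_bounds j
    push_cast
    exact this
  · exact ⟨(hq.latency_one (by omega)).2, hq.apply_some⟩
  · exact Contention.isAnonymousEquilibrium_of_apply hq.1 hq.2
  · have hn' : (Contention.pending h).card ≤ n := by
      simpa using Finset.card_le_univ (Contention.pending h)
    have hlat := Contention.futureLatency_deviation q q hi
    rw [Contention.deviation_self, hq.latency_eq_ofReal _ (by omega) hn'] at hlat
    rw [hlat]
    obtain ⟨j, hj⟩ := Nat.exists_eq_add_of_le' hcard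
    rw [hj]
    have hpos : 0 < Contention.equilibriumLatency (j + 2) := by
      linarith [Contention.one_le_equilibriumLatency (j + 2)]
    have hlow : 1 / 5 * √(j + 2 : ℝ) ≤ Real.log (Contention.equilibriumLatency (j + 2)) :=
      Contention.log_stageValue_lower j
    have hup : Real.log (Contention.equilibriumLatency (j + 2)) ≤ 4 * √(j + 2 : ℝ) :=
      Contention.log_stageValue_upper j
    have hs : 0 ≤ √(j + 2 : ℝ) := Real.sqrt_nonneg _
    push_cast
    constructor
    · refine ENNReal.ofReal_le_ofReal ?_
      rw [← Real.le_log_iff_exp_le hpos]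
      linarith
    · refine ENNReal.ofReal_le_ofReal ?_
      rw [← Real.log_le_iff_le_exp hpos]
      linarith
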